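/- Let $k\ge 1$, let $I=\mathbb{Z}/(k+1)$, and let $W=\tilde S_{k+1}$ be the affine symmetric group with its Coxeter generators $\{s_i\mid i\in I\}$ (the Coxeter group of affine type $A_k^{(1)}$; for $k=1$ the infinite dihedral group), length function $l$ and identity $e$. Let $\le$ be the strong (Bruhat) order on $W$. For $s=s_i$ put $\phi_s(x)=x$ if $sx<x$ and $\phi_s(x)=sx$ if $sx>x$; for $x\in W$ with reduced expression $x=s_{i_1}\cdots s_{i_n}$ put $\phi_x=\phi_{s_{i_1}}\circ\cdots\circ\phi_{s_{i_n}}$, and let $x*y=\phi_x(y)$ be the Demazure product. For a proper subset $A\subsetneq I$ let $d_A=s_{i_1}\cdots s_{i_m}$ be the cyclically decreasing element, where $i_1,\dots,i_m$ are the distinct elements of $A$ listed so that no $j$ precedes $j+1$. For $A\subsetneq I$ and $u,w\in W$ put $$X_{A,u}=\{v\in W\mid d_A*v=u\},\qquad Y_{A,u}=X_{A,u}\cap[e,w],$$ where $[e,w]=\{v\in W \mid e\le v\le w\}$, and $$X'_{A,u}=\{B\subsetneq I\mid d_B^{-1}u\in X_{A,u}\},\qquad Y'_{A,u}=\{B\subsetneq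 I\mid d_B^{-1}u\in Y_{A,u}\}.$$ Then the map $B\mapsto d_B^{-1}u$ is an anti-isomorphism of posets from $(X'_{A,u},\subseteq)$ onto $(X_{A,u},\le)$ and from $(Y'_{A,u},\subseteq)$ onto $(Y_{A,u},\le)$. If $X_{A,u}\neq\emptyset$, then $$X'_{A,u}=\Bigl[\bigcap X'_{A,u},\,A\Bigr]=\Bigl\{B\Bigm| \bigcap X'_{A,u}\subseteq B\subseteq A\Bigr\},$$ and if $Y_{A,u}\neq\emptyset$, then $$Y'_{A,u}=\Bigl[\bigcap Y'_{A,u},\,A\Bigr].$$ In particular, if $X_{A,u}$ (respectively $Y_{A,u}$) is nonempty, then $(X'_{A,u},\subseteq)$ and $(X_{A,u},\le)$ (respectively $(Y'_{A,u},\subseteq)$ and $(Y_{A,u},\le)$) are isomorphic to boolean posets, that is, to posets of all subsets of a finite set ordered by inclusion. -/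

import Mathlib

namespace CoxeterSystem

variable {B W : Type*} [Group W] {M : CoxeterMatrix B} (cs : CoxeterSystem M W)

/-- The covering relation of the strong (Bruhat) order: `v = t u` for a reflection `t`, and
`ℓ v = ℓ u + 1`. -/
def StrongCovBy (u v : W) : Prop :=
  cs.length v = cs.length u + 1 ∧ ∃ t, cs.IsReflection t ∧ v = t * u

/-- The strong (Bruhat) order, generated by its covering relation. -/
def StrongLE : W → W → Prop :=
  Relation.ReflTransGen cs.StrongCovBy

open scoped Classical in
/-- The Demazure action `φ_s` of the simple reflection `s = s_i`:
`φ_s x = x` if `s x < x`, and `φ_s x = s x` if `s x > x`. -/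
noncomputable def demazureSimple (i : B) (x : W) : W :=
  if cs.IsLeftDescent x i then x else cs.simple i * x

/-- The composite `φ_{i_1} ∘ ⋯ ∘ φ_{i_n}` for a word `i_1 … i_n`. -/
noncomputable def demazureWord (ω : List B) (y : W) : W :=
  ω.foldr cs.demazureSimple y

/-- The Demazure product `x * y = φ_x y`, where `φ_x = φ_{i_1} ∘ ⋯ ∘ φ_{i_n}` for a reduced word
`i_1 … i_n` of `x` (the composite does not depend on which reduced word is taken). -/
noncomputable def demazureProd (x y : W) : W :=
  cs.demazureWord (cs.exists_isReduced x).choose y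

end CoxeterSystem

/-- The Coxeter matrix of the affine symmetric group `S̃_{k+1}`, with index set `ℤ/(k+1)`.
For `k = 1` the product of the two generators has infinite order, which is encoded by `0`. -/
def affineCoxeterMatrix (k : ℕ) : CoxeterMatrix (ZMod (k + 1)) where
  M := Matrix.of fun i j =>
    if i = j then 1
    else if k = 1 then 0
    else if j = i + 1 ∨ i = j + 1 then 3
    else 2
  isSymm := by
    ext i j
    simp only [Matrix.transpose_apply, Matrix.of_apply, eq_comm (a := j) (b := i),
      or_comm (a := i = j + 1)]
  diagonal := by simp
  off_diagonal := by
    intro i j h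
    simp only [Matrix.of_apply, if_neg h]
    split_ifs <;> decide

/-- The affine symmetric group `S̃_{k+1}`, given by its Coxeter presentation. -/
abbrev AffineSymmetricGroup (k : ℕ) : Type := (affineCoxeterMatrix k).Group

namespace AffineSymmetricGroup

variable {k : ℕ}

/-- The Coxeter system `(S̃_{k+1}, {s_i : i ∈ ℤ/(k+1)})`. -/
abbrev cs (k : ℕ) : CoxeterSystem (affineCoxeterMatrix k) (AffineSymmetricGroup k) :=
  (affineCoxeterMatrix k).toCoxeterSystem

/-- A word is cyclically decreasing if its letters are distinct and no letter `j` precedes the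
letter `j + 1`. -/
def IsCyclicallyDecreasing (a : List (ZMod (k + 1))) : Prop :=
  a.Nodup ∧ a.Pairwise fun x y => y ≠ x + 1

/-- Every proper subset of `ℤ/(k+1)` is the set of letters of a cyclically decreasing word. -/
theorem exists_isCyclicallyDecreasing {A : Set (ZMod (k + 1))} (hA : A ≠ Set.univ) :
    ∃ a : List (ZMod (k + 1)), IsCyclicallyDecreasing a ∧ {i | i ∈ a} = A := by
  classical
  obtain ⟨c, hc⟩ := (Set.ne_univ_iff_exists_notMem A).1 hA
  have hinj : ∀ m n : ℕ, m ≤ k → n ≤ k → (m : ZMod (k + 1)) = n → m = n := by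
    intro m n hm hn h
    have h' := congrArg ZMod.val h
    rwa [ZMod.val_natCast_of_lt (by omega), ZMod.val_natCast_of_lt (by omega)] at h'
  refine ⟨((List.range k).map fun m : ℕ => c - 1 - (m : ZMod (k + 1))).filter (· ∈ A),
    ⟨List.Nodup.filter _ ?_, List.Pairwise.filter _ ?_⟩, ?_⟩
  · refine List.Nodup.map_on ?_ List.nodup_range
    intro m hm n hn h
    rw [List.mem_range] at hm hn
    exact hinj m n hm.le hn.le (by simpa using h)
  · rw [List.pairwise_map]
    refine List.Pairwise.imp_of_mem ?_ List.pairwise_lt_range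
    intro m n hm hn hlt h
    rw [List.mem_range] at hm hn
    have h2 : ((n + 1 : ℕ) : ZMod (k + 1)) = (m : ℕ) := by
      push_cast
      linear_combination -h
    have := hinj _ _ (by omega) hm.le h2
    omega
  · ext i
    simp only [List.mem_filter, List.mem_map, List.mem_range, decide_eq_true_eq, Set.mem_ofPred_eq,
      and_iff_right_iff_imp]
    intro hi
    have hv : (((c - 1 - i).val : ℕ) : ZMod (k + 1)) = c - 1 - i := ZMod.natCast_zmod_val _
    refine ⟨(c - 1 - i).val, ?_, by rw [hv]; ring⟩
    have hlt := ZMod.val_lt (c - 1 - i)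
    rcases Nat.lt_succ_iff_lt_or_eq.1 hlt with h | h
    · exact h
    · exfalso
      rw [h] at hv
      have h0 : ((k : ZMod (k + 1)) + 1) = 0 := by exact_mod_cast ZMod.natCast_self (k + 1)
      have : i = c := by linear_combination hv - h0
      exact hc (this ▸ hi)

open scoped Classical in
/-- The cyclically decreasing element `d_A = s_{i_1} ⋯ s_{i_m}` of a proper subset `A` of
`ℤ/(k+1)`, where `i_1 … i_m` is a cyclically decreasing word with set of letters `A` (the product
does not depend on which such word is taken). The value at `A = ℤ/(k+1)` is irrelevant. -/
noncomputable def cycDec (A : Set (ZMod (k + 1))) : AffineSymmetricGroup k :=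
  if hA : A ≠ Set.univ then (cs k).wordProd (exists_isCyclicallyDecreasing hA).choose else 1

/-- The fiber `X_{A,u} = {v | d_A * v = u}` of the Demazure action of `d_A`. -/
def fiberX (A : Set (ZMod (k + 1))) (u : AffineSymmetricGroup k) :
    Set (AffineSymmetricGroup k) :=
  {v | (cs k).demazureProd (cycDec A) v = u}

/-- The truncation `Y_{A,u} = X_{A,u} ∩ [e, w]`, where `[e, w]` is a strong interval. -/
def fiberY (A : Set (ZMod (k + 1))) (u w : AffineSymmetricGroup k) :
    Set (AffineSymmetricGroup k) :=
  fiberX A u ∩ {v | (cs k).StrongLE 1 v ∧ (cs k).StrongLE v w}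

/-- The map `B ↦ d_B⁻¹ u`. -/
noncomputable def cycDecInvMul (u : AffineSymmetricGroup k) (B : Set (ZMod (k + 1))) :
    AffineSymmetricGroup k :=
  (cycDec B)⁻¹ * u

/-- For a set `X` of elements, the family `X' = {B ⊊ ℤ/(k+1) | d_B⁻¹ u ∈ X}`. -/
def indexFamily (u : AffineSymmetricGroup k) (X : Set (AffineSymmetricGroup k)) :
    Set (Set (ZMod (k + 1))) :=
  {B | B ≠ Set.univ ∧ cycDecInvMul u B ∈ X}

/-- `B ↦ d_B⁻¹ u` is an anti-isomorphism from `(𝓕, ⊆)` onto `(X, ≤)`, where `≤` is the strong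
order. -/
def IsAntiIso (u : AffineSymmetricGroup k) (𝓕 : Set (Set (ZMod (k + 1))))
    (X : Set (AffineSymmetricGroup k)) : Prop :=
  Set.BijOn (cycDecInvMul u) 𝓕 X ∧
    ∀ B ∈ 𝓕, ∀ C ∈ 𝓕, B ⊆ C ↔ (cs k).StrongLE (cycDecInvMul u C) (cycDecInvMul u B)

end AffineSymmetricGroup

/-- The set `s` with the relation `r` is a boolean poset: it is isomorphic to the poset of all
subsets of a finite set under inclusion. -/
def IsBooleanPoset {α : Type*} (r : α → α → Prop) (s : Set α) : Prop :=
  ∃ n : ℕ, Nonempty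
    (Subrel r (· ∈ s) ≃r ((· ⊆ ·) : Set (Fin n) → Set (Fin n) → Prop))

namespace CoxeterSystem

variable {B W : Type*} [Group W] {M : CoxeterMatrix B} (cs : CoxeterSystem M W)

/-! ### The inversion cocycle and the strong exchange property -/

/-! Let `a` be a reduced word of d_A with distinct letters. When φ_a is applied to v, each letter
either multiplies or does nothing. If S is the set of letters that multiply, then φ_a(v) = d_S v, so
the fiber over u consists of elements d_S⁻¹u with S ⊆ A. Which S occur is recorded by `DescentChain
a S u`: every letter of `a`, used or skipped, must be a left descent when it is read.

The family of such S is closed upwards inside A, and enlarging S lowers d_S⁻¹u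
(`descentChain_mono`). Conversely, comparability in the strong order forces inclusion
(`mem_of_strongLE`). Both follow by squeezing Demazure products, since φ_ω(y) is the largest of the
products of a subword of ω with y. The family is also closed under intersection
(`descentChain_inter`). Here A being proper matters: it cuts the cycle open, so letters of `a` at
nonadjacent positions commute. A finite family with these closure properties is an interval with top
A.

For the truncation, v ≤ w is inherited downwards in the strong order, so only closure under
intersection remains. Deodhar's criterion reduces x ≤ w to finding, for each r, an element of the
coset W_r x below w, where W_r is generated by the simple reflections other than s_r. For each r,
the element d_{S∩T}⁻¹u shares its coset with d_S⁻¹u or with d_T⁻¹u.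

The Coxeter-theoretic inputs are strong exchange, from a sign cocycle counting inversions mod 2, and
s_r ∉ W_r, from the action on the affine root lattice. -/

theorem _root_.Function.End.mul_apply' {α : Type*} (f g : Function.End α) (x : α) :
    (f * g) x = f (g x) := rfl

theorem _root_.Function.End.one_apply' {α : Type*} (x : α) : (1 : Function.End α) x = x := rfl

open scoped Classical in
/-- The action of a simple reflection on pairs (group element, sign). -/
noncomputable def signedConj (i : B) : Function.End (W × ZMod 2) := fun p =>
  (cs.simple i * p.1 * cs.simple i, p.2 + if p.1 = cs.simple i then 1 else 0)

open scoped Classical in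
theorem signedConj_mul_pow (i j : B) (m : ℕ) (t : W) (e : ZMod 2) :
    ((cs.signedConj i * cs.signedConj j) ^ m) (t, e) =
      ((cs.simple i * cs.simple j) ^ m * t * ((cs.simple i * cs.simple j) ^ m)⁻¹,
        e + ∑ n ∈ Finset.range (2 * m),
          if t = cs.simple j * (cs.simple i * cs.simple j) ^ n then 1 else 0) := by
  induction m with
  | zero => simp [Function.End.one_apply']
  | succ m ih =>
    rw [pow_succ', Function.End.mul_apply', ih]
    set c := cs.simple i * cs.simple j with hc
    have hsj : cs.simple j * cs.simple j = 1 := cs.simple_mul_simple_self j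
    have hcinv : c⁻¹ = cs.simple j * cs.simple i := by simp [hc]
    have hconj : ∀ n : ℕ, cs.simple j * c ^ n = (c ^ n)⁻¹ * cs.simple j := by
      intro n
      induction n with
      | zero => simp
      | succ n ihn =>
        rw [pow_succ, ← mul_assoc, ihn, mul_inv_rev, hcinv, mul_assoc, hc]
        have : (c ^ n)⁻¹ * (cs.simple j * cs.simple i) = (cs.simple j * cs.simple i) * (c ^ n)⁻¹ := by
          rw [← hcinv, ← inv_pow]
          exact (Commute.refl c⁻¹).pow_left n
        rw [← this]
        simp [mul_assoc, ← hc]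
    have h1 : c ^ m * t * (c ^ m)⁻¹ = cs.simple j ↔ t = cs.simple j * c ^ (2 * m) := by
      rw [two_mul, pow_add, ← mul_assoc, hconj, mul_assoc]
      constructor
      · intro h; rw [← h]; group
      · rintro rfl; group
    have h2 : cs.simple j * (c ^ m * t * (c ^ m)⁻¹) * cs.simple j = cs.simple i ↔
        t = cs.simple j * c ^ (2 * m + 1) := by
      have e1 : cs.simple j * c ^ (2 * m + 1) = (c ^ m)⁻¹ * (cs.simple j * c) * c ^ m := by
        have : 2 * m + 1 = m + (1 + m) := by ring
        rw [this, pow_add, ← mul_assoc, hconj, pow_add, pow_one]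
        simp only [mul_assoc]
      have e2 : cs.simple j * c = cs.simple j * cs.simple i * cs.simple j := by rw [hc, mul_assoc]
      rw [e1, e2]
      constructor
      · intro h; rw [← h]
        simp only [mul_assoc, hsj, mul_one]
        rw [← mul_assoc (cs.simple j) (cs.simple j), hsj]; group
      · rintro rfl
        have : c ^ m * ((c ^ m)⁻¹ * (cs.simple j * cs.simple i * cs.simple j) * c ^ m) * (c ^ m)⁻¹
          = cs.simple j * cs.simple i * cs.simple j := by group
        rw [this]
        simp [mul_assoc]
    have hs : 2 * (m + 1) = 2 * m + 1 + 1 := by ring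
    rw [hs, Finset.sum_range_succ, Finset.sum_range_succ, Function.End.mul_apply']
    simp only [signedConj, h1, h2]
    refine Prod.ext ?_ ?_
    · simp only [pow_succ', mul_inv_rev, hcinv]
      rw [hc]
      simp only [mul_assoc]
    · simp only [add_assoc]

theorem isLiftable_signedConj : M.IsLiftable cs.signedConj := by
  classical
  intro i j
  funext p
  obtain ⟨t, e⟩ := p
  rw [signedConj_mul_pow, cs.simple_mul_simple_pow]
  have : ∑ n ∈ Finset.range (2 * M i j),
      (if t = cs.simple j * (cs.simple i * cs.simple j) ^ n then (1 : ZMod 2) else 0) = 0 := by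
    -- The summands have period `M i j`, so the two halves agree and cancel mod 2.
    rw [two_mul, Finset.sum_range_add]
    simp only [pow_add, cs.simple_mul_simple_pow, one_mul]
    exact CharTwo.add_self_eq_zero _
  rw [this]
  simp [Function.End.one_apply']

/-- The action of the Coxeter group on pairs (group element, sign). -/
noncomputable def signedConjHom : W →* Function.End (W × ZMod 2) :=
  cs.lift ⟨cs.signedConj, cs.isLiftable_signedConj⟩

theorem signedConjHom_simple (i : B) : cs.signedConjHom (cs.simple i) = cs.signedConj i :=
  cs.lift_apply_simple _ i

/-- The inversion cocycle: for a reflection `t`, it is `1` if `t` is a left inversion of `w` and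
`0` otherwise. -/
noncomputable def inversionSign (w t : W) : ZMod 2 := (cs.signedConjHom w⁻¹ (t, 0)).2

theorem signedConjHom_apply (w t : W) (e : ZMod 2) :
    cs.signedConjHom w (t, e) = (w * t * w⁻¹, e + cs.inversionSign w⁻¹ t) := by
  classical
  unfold inversionSign
  rw [inv_inv]
  revert t e
  induction w using cs.simple_induction_left with
  | one => intro t e; simp [Function.End.one_apply']
  | mul_simple_left w i ih =>
    intro t e
    rw [map_mul, Function.End.mul_apply', Function.End.mul_apply', ih,
      signedConjHom_simple, ih t 0]
    simp [signedConj, mul_assoc, add_assoc]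

theorem inversionSign_one (t : W) : cs.inversionSign 1 t = 0 := by
  simp [inversionSign, Function.End.one_apply']

theorem inversionSign_mul (x y t : W) :
    cs.inversionSign (x * y) t = cs.inversionSign x t + cs.inversionSign y (x⁻¹ * t * x) := by
  have h : cs.signedConjHom (x * y)⁻¹ (t, 0) =
      cs.signedConjHom y⁻¹ (cs.signedConjHom x⁻¹ (t, 0)) := by
    rw [mul_inv_rev, map_mul]; rfl
  simp only [signedConjHom_apply, inv_inv] at h
  simpa using congrArg Prod.snd h

open scoped Classical in
theorem inversionSign_simple (i : B) (t : W) :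
    cs.inversionSign (cs.simple i) t = if t = cs.simple i then 1 else 0 := by
  simp [inversionSign, signedConjHom_simple, signedConj]

/-- For t = x s x⁻¹ the contributions of x and x⁻¹ cancel, by the cocycle identity for x x⁻¹ = 1;
the middle s contributes 1. -/
theorem inversionSign_self {t : W} (ht : cs.IsReflection t) : cs.inversionSign t t = 1 := by
  obtain ⟨x, i, rfl⟩ := ht
  have h := cs.inversionSign_mul x x⁻¹ (x * cs.simple i * x⁻¹)
  rw [mul_inv_cancel, inversionSign_one] at h
  rw [mul_assoc x, inversionSign_mul, inversionSign_mul]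
  simp only [mul_assoc, inv_mul_cancel_left, inv_mul_cancel, mul_one] at h ⊢
  simp only [inversionSign_simple, if_true, one_mul]
  rw [add_left_comm, ← h, add_zero]

/-- Expanded along ω, the cocycle counts mod 2 the positions whose conjugated letter is t; a nonzero
count means there is one. -/
theorem exists_eq_of_inversionSign_ne_zero {ω : List B} {t : W}
    (h : cs.inversionSign (cs.wordProd ω) t ≠ 0) :
    ∃ l₁ r l₂, ω = l₁ ++ r :: l₂ ∧
      t = cs.wordProd l₁ * cs.simple r * (cs.wordProd l₁)⁻¹ := by
  classical
  induction ω generalizing t with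
  | nil => simp [inversionSign_one] at h
  | cons i ω ih =>
    rw [wordProd_cons, inversionSign_mul, inversionSign_simple] at h
    by_cases hi : t = cs.simple i
    · exact ⟨[], i, ω, rfl, by simp [hi]⟩
    · rw [if_neg hi, zero_add] at h
      obtain ⟨l₁, r, l₂, rfl, h2⟩ := ih h
      refine ⟨i :: l₁, r, l₂, rfl, ?_⟩
      rw [wordProd_cons]
      have : t = cs.simple i * ((cs.simple i)⁻¹ * t * cs.simple i) * (cs.simple i)⁻¹ := by group
      rw [this, h2]
      group

theorem conj_mul_wordProd (l₁ l₂ : List B) (r : B) :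
    cs.wordProd l₁ * cs.simple r * (cs.wordProd l₁)⁻¹ * cs.wordProd (l₁ ++ r :: l₂) =
      cs.wordProd (l₁ ++ l₂) := by
  rw [wordProd_append, wordProd_append, wordProd_cons]
  simp only [mul_assoc, inv_mul_cancel_left, simple_mul_simple_cancel_left]

theorem length_mul_lt_of_inversionSign_ne_zero {w t : W} (h : cs.inversionSign w t ≠ 0) :
    cs.length (t * w) < cs.length w := by
  obtain ⟨ω, hω, rfl⟩ := cs.exists_isReduced w
  obtain ⟨l₁, r, l₂, rfl, rfl⟩ := cs.exists_eq_of_inversionSign_ne_zero h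
  rw [conj_mul_wordProd, hω.eq]
  have := cs.length_wordProd_le (l₁ ++ l₂)
  simp only [List.length_append, List.length_cons] at *
  omega

theorem inversionSign_ne_zero_iff {w t : W} (ht : cs.IsReflection t) :
    cs.inversionSign w t ≠ 0 ↔ cs.length (t * w) < cs.length w := by
  refine ⟨cs.length_mul_lt_of_inversionSign_ne_zero, fun h h0 => ?_⟩
  -- If the sign of w vanished, that of t w would be 1, and t (t w) = w would be shorter than t w.
  have h1 : cs.inversionSign (t * w) t ≠ 0 := by
    rw [inversionSign_mul, cs.inversionSign_self ht, ht.inv, ht.mul_self, one_mul, h0]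
    simp
  have h2 := cs.length_mul_lt_of_inversionSign_ne_zero h1
  rw [← mul_assoc, ht.mul_self, one_mul] at h2
  omega

theorem isLeftDescent_iff_inversionSign {w : W} {i : B} :
    cs.IsLeftDescent w i ↔ cs.inversionSign w (cs.simple i) ≠ 0 :=
  (cs.inversionSign_ne_zero_iff (cs.isReflection_simple i)).symm

/-- The strong exchange property. -/
theorem strong_exchange {ω : List B} {t : W} (ht : cs.IsReflection t)
    (h : cs.length (t * cs.wordProd ω) < cs.length (cs.wordProd ω)) :
    ∃ l₁ r l₂, ω = l₁ ++ r :: l₂ ∧ t = cs.wordProd l₁ * cs.simple r * (cs.wordProd l₁)⁻¹ ∧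
      t * cs.wordProd ω = cs.wordProd (l₁ ++ l₂) := by
  obtain ⟨l₁, r, l₂, rfl, rfl⟩ :=
    cs.exists_eq_of_inversionSign_ne_zero ((cs.inversionSign_ne_zero_iff ht).2 h)
  exact ⟨l₁, r, l₂, rfl, rfl, cs.conj_mul_wordProd l₁ l₂ r⟩

end CoxeterSystem

namespace CoxeterSystem

variable {B W : Type*} [Group W] {M : CoxeterMatrix B} (cs : CoxeterSystem M W)

/-! ### The strong order -/

variable {cs} in
theorem StrongLE.refl (x : W) : cs.StrongLE x x := Relation.ReflTransGen.refl

variable {cs} in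
theorem StrongLE.trans {x y z : W} (h : cs.StrongLE x y) (h' : cs.StrongLE y z) :
    cs.StrongLE x z := Relation.ReflTransGen.trans h h'

variable {cs} in
theorem StrongCovBy.le {x y : W} (h : cs.StrongCovBy x y) : cs.StrongLE x y :=
  Relation.ReflTransGen.single h

variable {cs} in
theorem StrongLE.eq_or_length_lt {x y : W} (h : cs.StrongLE x y) :
    x = y ∨ cs.length x < cs.length y := by
  induction h with
  | refl => exact Or.inl rfl
  | tail _ h ih =>
    right
    have := h.1
    rcases ih with rfl | ih <;> omega

variable {cs} in
theorem StrongLE.antisymm {x y : W} (h : cs.StrongLE x y) (h' : cs.StrongLE y x) : x = y := by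
  rcases h.eq_or_length_lt with h | h
  · exact h
  rcases h'.eq_or_length_lt with h' | h'
  · exact h'.symm
  omega

variable {cs} in
theorem StrongCovBy.inv {x y : W} (h : cs.StrongCovBy x y) : cs.StrongCovBy x⁻¹ y⁻¹ := by
  obtain ⟨hl, t, ht, rfl⟩ := h
  refine ⟨by rw [cs.length_inv, cs.length_inv]; exact hl, x⁻¹ * t * x⁻¹⁻¹, ht.conj x⁻¹, ?_⟩
  rw [mul_inv_rev, ht.inv]
  group

variable {cs} in
theorem StrongLE.inv {x y : W} (h : cs.StrongLE x y) : cs.StrongLE x⁻¹ y⁻¹ := by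
  induction h with
  | refl => exact StrongLE.refl _
  | tail _ h ih => exact ih.trans h.inv.le

theorem strongCovBy_simple_mul {x : W} {i : B} (h : ¬ cs.IsLeftDescent x i) :
    cs.StrongCovBy x (cs.simple i * x) :=
  ⟨cs.not_isLeftDescent_iff.1 h, _, cs.isReflection_simple i, rfl⟩

theorem strongCovBy_of_isLeftDescent {x : W} {i : B} (h : cs.IsLeftDescent x i) :
    cs.StrongCovBy (cs.simple i * x) x :=
  ⟨(cs.isLeftDescent_iff.1 h).symm, _, cs.isReflection_simple i, by simp⟩

variable {cs} in
-- Apply strong exchange to a reduced word of y starting with i. Deleting any letter but the first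
-- would leave i a descent of x.
theorem StrongCovBy.eq_simple_mul {x y : W} (h : cs.StrongCovBy x y) {i : B}
    (hx : ¬ cs.IsLeftDescent x i) (hy : cs.IsLeftDescent y i) : x = cs.simple i * y := by
  obtain ⟨hl, t, ht, rfl⟩ := h
  obtain ⟨ω, hω, hω'⟩ := cs.exists_isReduced (cs.simple i * (t * x))
  have hy' : t * x = cs.wordProd (i :: ω) := by rw [wordProd_cons, ← hω']; simp
  have hx' : t * cs.wordProd (i :: ω) = x := by
    rw [← hy', ← mul_assoc, ht.mul_self, one_mul]
  have hlen : ω.length + 1 = cs.length x + 1 := by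
    rw [← hω.eq, ← hω', ← hl, ← cs.isLeftDescent_iff.1 hy]
  obtain ⟨l₁, r, l₂, h1, -, h3⟩ := cs.strong_exchange (ω := i :: ω) ht
    (by rw [hx', ← hy', hl]; omega)
  rw [hx'] at h3
  rcases l₁ with _ | ⟨a, l₁⟩
  · obtain ⟨rfl, rfl⟩ := List.cons.inj h1
    rw [hω']; exact h3
  · rw [List.cons_append] at h1
    obtain ⟨rfl, rfl⟩ := List.cons.inj h1
    exfalso
    apply hx
    rw [List.cons_append, wordProd_cons] at h3
    have h4 : cs.simple i * x = cs.wordProd (l₁ ++ l₂) := by rw [h3]; simp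
    have h5 := cs.length_wordProd_le (l₁ ++ l₂)
    rw [IsLeftDescent, h4]
    simp only [List.length_append, List.length_cons] at *
    omega

theorem le_demazureSimple (i : B) (x : W) : cs.StrongLE x (cs.demazureSimple i x) := by
  unfold demazureSimple
  split_ifs with h
  · exact StrongLE.refl _
  · exact (cs.strongCovBy_simple_mul h).le

theorem simple_mul_le_demazureSimple (i : B) (x : W) :
    cs.StrongLE (cs.simple i * x) (cs.demazureSimple i x) := by
  unfold demazureSimple
  split_ifs with h
  · exact (cs.strongCovBy_of_isLeftDescent h).le
  · exact StrongLE.refl _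

open scoped Classical in
/-- The smaller of `x` and `s_i x`. -/
noncomputable def simpleMin (i : B) (x : W) : W :=
  if cs.IsLeftDescent x i then cs.simple i * x else x

theorem simpleMin_le (i : B) (x : W) : cs.StrongLE (cs.simpleMin i x) x := by
  unfold simpleMin
  split_ifs with h
  · exact (cs.strongCovBy_of_isLeftDescent h).le
  · exact StrongLE.refl _

variable {cs} in
theorem StrongCovBy.simple_mul {x y : W} (h : cs.StrongCovBy x y) {i : B}
    (hl : cs.length (cs.simple i * y) = cs.length (cs.simple i * x) + 1) :
    cs.StrongCovBy (cs.simple i * x) (cs.simple i * y) := by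
  obtain ⟨_, t, ht, rfl⟩ := h
  refine ⟨hl, cs.simple i * t * (cs.simple i)⁻¹, ht.conj _, by group⟩

variable {cs} in
theorem StrongLE.demazureSimple {x y : W} (h : cs.StrongLE x y) (i : B) :
    cs.StrongLE (cs.demazureSimple i x) (cs.demazureSimple i y) := by
  induction h with
  | refl => exact StrongLE.refl _
  | @tail y z _ h ih =>
    refine ih.trans ?_
    have hl := h.1
    by_cases hy : cs.IsLeftDescent y i
    · rw [CoxeterSystem.demazureSimple, if_pos hy]
      exact h.le.trans (cs.le_demazureSimple i z)
    by_cases hz : cs.IsLeftDescent z i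
    · have := h.eq_simple_mul hy hz
      rw [CoxeterSystem.demazureSimple, if_neg hy, this]
      simpa using cs.le_demazureSimple i z
    · rw [CoxeterSystem.demazureSimple, CoxeterSystem.demazureSimple, if_neg hy, if_neg hz]
      rw [not_isLeftDescent_iff] at hy hz
      exact (h.simple_mul (by omega)).le

variable {cs} in
theorem StrongLE.simpleMin {x y : W} (h : cs.StrongLE x y) (i : B) :
    cs.StrongLE (cs.simpleMin i x) (cs.simpleMin i y) := by
  induction h with
  | refl => exact StrongLE.refl _
  | @tail y z _ h ih =>
    refine ih.trans ?_
    have hl := h.1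
    by_cases hz : cs.IsLeftDescent z i
    · by_cases hy : cs.IsLeftDescent y i
      · rw [CoxeterSystem.simpleMin, CoxeterSystem.simpleMin, if_pos hy, if_pos hz]
        rw [isLeftDescent_iff] at hy hz
        exact (h.simple_mul (by omega)).le
      · have := h.eq_simple_mul hy hz
        rw [CoxeterSystem.simpleMin, CoxeterSystem.simpleMin, if_neg hy, if_pos hz, this]
        exact StrongLE.refl _
    · rw [CoxeterSystem.simpleMin.eq_1 cs i z, if_neg hz]
      exact (cs.simpleMin_le i y).trans h.le

theorem one_strongLE (x : W) : cs.StrongLE 1 x := by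
  induction hn : cs.length x generalizing x with
  | zero => rw [cs.length_eq_zero_iff.1 hn]; exact StrongLE.refl _
  | succ n ih =>
    obtain ⟨i, hi⟩ := cs.exists_leftDescent_of_ne_one (w := x) (by rintro rfl; simp at hn)
    exact (ih _ (by have := cs.isLeftDescent_iff.1 hi; omega)).trans
      (cs.strongCovBy_of_isLeftDescent hi).le

/-- One half of the subword property. -/
theorem exists_sublist_of_strongLE {x : W} {ω : List B} (h : cs.StrongLE x (cs.wordProd ω)) :
    ∃ τ, τ.Sublist ω ∧ cs.wordProd τ = x := by
  induction h using Relation.ReflTransGen.head_induction_on with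
  | refl => exact ⟨ω, List.Sublist.refl _, rfl⟩
  | @head x y hxy _ ih =>
    obtain ⟨τ, hτ, rfl⟩ := ih
    obtain ⟨hl, t, ht, hy⟩ := hxy
    have hx : t * cs.wordProd τ = x := by rw [hy, ← mul_assoc, ht.mul_self, one_mul]
    obtain ⟨l₁, r, l₂, rfl, -, h3⟩ := cs.strong_exchange (ω := τ) ht (by rw [hx]; omega)
    refine ⟨l₁ ++ l₂, List.Sublist.trans ?_ hτ, by rw [← h3, hx]⟩
    exact List.Sublist.append_left (List.sublist_cons_self r l₂) l₁

/-! ### The Demazure product -/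

theorem demazureWord_cons (i : B) (ω : List B) (y : W) :
    cs.demazureWord (i :: ω) y = cs.demazureSimple i (cs.demazureWord ω y) := rfl

theorem demazureWord_append (ω ω' : List B) (y : W) :
    cs.demazureWord (ω ++ ω') y = cs.demazureWord ω (cs.demazureWord ω' y) := by
  simp [demazureWord]

variable {cs} in
theorem StrongLE.demazureWord {x y : W} (h : cs.StrongLE x y) {ω ω' : List B}
    (hω : ω.Sublist ω') : cs.StrongLE (cs.demazureWord ω x) (cs.demazureWord ω' y) := by
  induction hω with
  | slnil => exact h
  | cons i _ ih => exact ih.trans (cs.le_demazureSimple i _)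
  | cons_cons i _ ih => exact ih.demazureSimple i

theorem wordProd_mul_le_demazureWord (ω : List B) (y : W) :
    cs.StrongLE (cs.wordProd ω * y) (cs.demazureWord ω y) := by
  induction ω with
  | nil => rw [wordProd_nil, one_mul]; exact StrongLE.refl y
  | cons i ω ih =>
    rw [wordProd_cons, mul_assoc]
    exact (cs.simple_mul_le_demazureSimple i _).trans (ih.demazureSimple i)

/-- τ consists of the letters that multiply. With `wordProd_mul_le_demazureWord` this makes the
Demazure action a maximum over subwords. -/
theorem exists_demazureWord_eq (ω : List B) (y : W) :
    ∃ τ, τ.Sublist ω ∧ cs.demazureWord ω y = cs.wordProd τ * y ∧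
      cs.length (cs.wordProd τ * y) = τ.length + cs.length y := by
  classical
  induction ω with
  | nil => exact ⟨[], List.Sublist.refl _, by simp [demazureWord], by simp⟩
  | cons i ω ih =>
    obtain ⟨τ, hτ, h1, h2⟩ := ih
    rw [demazureWord_cons, h1, demazureSimple]
    split_ifs with h
    · exact ⟨τ, hτ.cons i, rfl, h2⟩
    · refine ⟨i :: τ, hτ.cons_cons i, by rw [wordProd_cons, mul_assoc], ?_⟩
      rw [wordProd_cons, mul_assoc, cs.not_isLeftDescent_iff.1 h, h2, List.length_cons]
      omega

theorem demazureWord_one_of_isReduced {ω : List B} (h : cs.IsReduced ω) :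
    cs.demazureWord ω 1 = cs.wordProd ω := by
  induction ω with
  | nil => rfl
  | cons i ω ih =>
    have hω : cs.IsReduced ω := h.drop 1
    rw [demazureWord_cons, ih hω, demazureSimple, if_neg, wordProd_cons]
    rw [not_isLeftDescent_iff, ← wordProd_cons, h.eq, hω.eq, List.length_cons]

/-- One half of the subword property. -/
theorem wordProd_le_of_sublist {τ ω : List B} (hω : cs.IsReduced ω) (h : τ.Sublist ω) :
    cs.StrongLE (cs.wordProd τ) (cs.wordProd ω) := by
  rw [← cs.demazureWord_one_of_isReduced hω]
  have := cs.wordProd_mul_le_demazureWord τ 1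
  rw [mul_one] at this
  exact this.trans ((StrongLE.refl 1).demazureWord h)

/-- The left side is attained by a subword of ω, whose product is also that of a subword of ω' by
the subword property. -/
theorem demazureWord_le_of_wordProd_eq {ω ω' : List B} (hω : cs.IsReduced ω)
    (h : cs.wordProd ω = cs.wordProd ω') (y : W) :
    cs.StrongLE (cs.demazureWord ω y) (cs.demazureWord ω' y) := by
  obtain ⟨τ, hτ, h1, -⟩ := cs.exists_demazureWord_eq ω y
  obtain ⟨τ', hτ', h2⟩ := cs.exists_sublist_of_strongLE (x := cs.wordProd τ) (ω := ω')
    (h ▸ cs.wordProd_le_of_sublist hω hτ)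
  rw [h1, ← h2]
  exact (cs.wordProd_mul_le_demazureWord τ' y).trans ((StrongLE.refl y).demazureWord hτ')

/-- The Demazure product can be computed from any reduced word. -/
theorem demazureProd_wordProd {ω : List B} (hω : cs.IsReduced ω) (y : W) :
    cs.demazureProd (cs.wordProd ω) y = cs.demazureWord ω y := by
  obtain ⟨h1, h2⟩ := (cs.exists_isReduced (cs.wordProd ω)).choose_spec
  exact (cs.demazureWord_le_of_wordProd_eq h1 h2.symm y).antisymm
    (cs.demazureWord_le_of_wordProd_eq hω h2 y)

theorem demazureWord_reverse_le (ω : List B) :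
    cs.StrongLE (cs.demazureWord ω.reverse 1) (cs.demazureWord ω 1)⁻¹ := by
  obtain ⟨τ, hτ, h1, -⟩ := cs.exists_demazureWord_eq ω.reverse 1
  have h2 : cs.StrongLE (cs.wordProd τ.reverse * 1) (cs.demazureWord ω 1) :=
    (cs.wordProd_mul_le_demazureWord τ.reverse 1).trans
      ((StrongLE.refl 1).demazureWord (by simpa using hτ.reverse))
  rw [h1]
  simpa using h2.inv

theorem demazureWord_reverse (ω : List B) :
    cs.demazureWord ω.reverse 1 = (cs.demazureWord ω 1)⁻¹ := by
  refine (cs.demazureWord_reverse_le ω).antisymm ?_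
  simpa using (cs.demazureWord_reverse_le ω.reverse).inv

/-- By inversion, the reversed word of v acts on the inverse of the product of ω; the letters that
multiply form a subword of v. -/
theorem exists_demazureWord_eq_wordProd_mul {ω : List B} (hω : cs.IsReduced ω) (v : W) :
    ∃ v', cs.StrongLE v' v ∧ cs.demazureWord ω v = cs.wordProd ω * v' := by
  obtain ⟨η, hη, rfl⟩ := cs.exists_isReduced v
  have h : (cs.demazureWord ω (cs.wordProd η))⁻¹ =
      cs.demazureWord η.reverse (cs.wordProd ω)⁻¹ := by
    rw [← cs.demazureWord_one_of_isReduced hη, ← demazureWord_append, ← demazureWord_reverse,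
      List.reverse_append, demazureWord_append,
      cs.demazureWord_one_of_isReduced ((cs.isReduced_reverse_iff ω).2 hω), wordProd_reverse]
  obtain ⟨τ, hτ, h1, -⟩ := cs.exists_demazureWord_eq η.reverse (cs.wordProd ω)⁻¹
  refine ⟨cs.wordProd τ.reverse, cs.wordProd_le_of_sublist hη (by simpa using hτ.reverse), ?_⟩
  rw [← inv_inv (cs.demazureWord ω _), h, h1, wordProd_reverse]
  group

/-! ### Maximal parabolic subgroups and Deodhar's criterion -/

/-- The maximal parabolic subgroup generated by the simple reflections other than `s_a`. -/
def avoid (a : B) : Subgroup W where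
  carrier := {p | ∃ ω : List B, a ∉ ω ∧ cs.wordProd ω = p}
  one_mem' := ⟨[], by simp, by simp⟩
  mul_mem' := by
    rintro _ _ ⟨ω, h, rfl⟩ ⟨ω', h', rfl⟩
    exact ⟨ω ++ ω', by simp [h, h'], cs.wordProd_append _ _⟩
  inv_mem' := by
    rintro _ ⟨ω, h, rfl⟩
    exact ⟨ω.reverse, by simpa using h, cs.wordProd_reverse _⟩

theorem wordProd_mem_avoid {a : B} {ω : List B} (h : a ∉ ω) : cs.wordProd ω ∈ cs.avoid a :=
  ⟨ω, h, rfl⟩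

theorem simple_mem_avoid {a i : B} (h : i ≠ a) : cs.simple i ∈ cs.avoid a :=
  ⟨[i], by simpa using h.symm, by simp [wordProd]⟩

theorem simple_mul_eq_mul_simple {y : W} {i j : B} (h : ¬ cs.IsRightDescent y j)
    (h' : cs.IsRightDescent (cs.simple i * y) j) : cs.simple i * y = y * cs.simple j := by
  have hj := cs.not_isRightDescent_iff.1 h
  have hj' := cs.isRightDescent_iff.1 h'
  have h1 := cs.length_simple_mul y i
  have h2 := cs.length_simple_mul (y * cs.simple j) i
  rw [← mul_assoc] at h2
  have e1 : ¬ cs.IsLeftDescent y i := by rw [not_isLeftDescent_iff]; omega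
  have e2 : cs.IsLeftDescent (y * cs.simple j) i := by
    rw [isLeftDescent_iff, ← mul_assoc]; omega
  have h3 : cs.StrongCovBy y (y * cs.simple j) :=
    ⟨hj, y * cs.simple j * y⁻¹, (cs.isReflection_simple j).conj y, by group⟩
  have h4 := h3.eq_simple_mul e1 e2
  conv_lhs => rw [h4]
  simp

/-- Reading the word of p from the right, some letter s_i creates the descent j. There s_i z = z
s_j, so the final s_j cancels s_i, leaving a shorter word that still avoids a. -/
theorem exists_mem_avoid_mul_eq {a : B} {p y : W} {j : B} (hp : p ∈ cs.avoid a)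
    (h : ¬ cs.IsRightDescent y j) (h' : cs.IsRightDescent (p * y) j) :
    ∃ q ∈ cs.avoid a, p * y * cs.simple j = q * y := by
  obtain ⟨ω, hω, rfl⟩ := hp
  induction ω with
  | nil => simp [h] at h'
  | cons i ω ih =>
    rw [List.mem_cons, not_or] at hω
    have hs := cs.simple_mem_avoid (Ne.symm hω.1)
    by_cases hd : cs.IsRightDescent (cs.wordProd ω * y) j
    · obtain ⟨q, hq, h1⟩ := ih hω.2 hd
      refine ⟨cs.simple i * q, mul_mem hs hq, ?_⟩
      rw [wordProd_cons, mul_assoc _ q, ← h1]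
      simp only [mul_assoc]
    · rw [wordProd_cons, mul_assoc] at h'
      have := cs.simple_mul_eq_mul_simple hd h'
      refine ⟨cs.wordProd ω, cs.wordProd_mem_avoid hω.2, ?_⟩
      rw [wordProd_cons, mul_assoc _ _ y, this]
      simp

/-- Every simple reflection lies outside the parabolic subgroup generated by the others. -/
def SimplesIndependent : Prop := ∀ r, cs.simple r ∉ cs.avoid r

variable {cs} in
theorem SimplesIndependent.inversionSign_eq_zero (h : cs.SimplesIndependent) {r : B} {w : W}
    (hw : w ∈ cs.avoid r) : cs.inversionSign w (cs.simple r) = 0 := by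
  by_contra h0
  obtain ⟨ω, hω, rfl⟩ := hw
  obtain ⟨l₁, j, l₂, rfl, h2⟩ := cs.exists_eq_of_inversionSign_ne_zero h0
  simp only [List.mem_append, List.mem_cons, not_or] at hω
  apply h r
  have h1 := cs.wordProd_mem_avoid hω.1
  rw [h2]
  exact mul_mem (mul_mem h1 (cs.simple_mem_avoid (Ne.symm hω.2.1))) (inv_mem h1)

variable {cs} in
theorem SimplesIndependent.not_isLeftDescent (h : cs.SimplesIndependent) {r : B} {w : W}
    (hw : w ∈ cs.avoid r) : ¬ cs.IsLeftDescent w r := by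
  rw [isLeftDescent_iff_inversionSign, h.inversionSign_eq_zero hw]
  simp

theorem simpleMin_right_le {x w : W} {j : B} (h : cs.StrongLE x w) (hw : cs.IsRightDescent w j) :
    cs.StrongLE x (w * cs.simple j) ∨
      (cs.IsRightDescent x j ∧ cs.StrongLE (x * cs.simple j) (w * cs.simple j)) := by
  have h1 := (h.inv.simpleMin j).inv
  rw [simpleMin.eq_1 cs j w⁻¹, if_pos (by rwa [isLeftDescent_inv_iff]), mul_inv_rev, inv_inv,
    inv_simple, simpleMin] at h1
  split_ifs at h1 with hx
  · rw [mul_inv_rev, inv_inv, inv_simple] at h1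
    rw [isLeftDescent_inv_iff] at hx
    exact Or.inr ⟨hx, h1⟩
  · rw [inv_inv] at h1
    exact Or.inl h1

variable {cs} in
/-- Deodhar's criterion: the strong order is detected on left cosets of maximal parabolic
subgroups. -/
theorem SimplesIndependent.strongLE_of_forall_avoid (hI : cs.SimplesIndependent) {x w : W}
    (h : ∀ a, ∃ p ∈ cs.avoid a, cs.StrongLE (p * x) w) : cs.StrongLE x w := by
  induction hn : cs.length w generalizing x w with
  | zero =>
    rw [cs.length_eq_zero_iff] at hn
    subst hn
    by_cases hx : x = 1
    · rw [hx]; exact StrongLE.refl _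
    obtain ⟨i, hi⟩ := cs.exists_leftDescent_of_ne_one hx
    obtain ⟨p, hp, hpx⟩ := h i
    have h1 : p * x = 1 := hpx.antisymm (cs.one_strongLE _)
    refine absurd hi (hI.not_isLeftDescent ?_)
    rw [← inv_eq_of_mul_eq_one_right h1]
    exact inv_mem hp
  | succ n ih =>
    obtain ⟨j, hj⟩ := cs.exists_rightDescent_of_ne_one (w := w) (by rintro rfl; simp at hn)
    have hl := cs.isRightDescent_iff.1 hj
    have hle : cs.StrongLE (w * cs.simple j) w := by
      have h1 := cs.strongCovBy_of_isLeftDescent (cs.isLeftDescent_inv_iff.2 hj)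
      simpa using h1.inv.le
    by_cases hx : cs.IsRightDescent x j
    · have hxj := cs.isRightDescent_iff_not_isRightDescent_mul.1 hx
      have h2 : cs.StrongLE (x * cs.simple j) (w * cs.simple j) := by
        refine ih (fun a => ?_) (by omega)
        obtain ⟨p, hp, hpx⟩ := h a
        rcases cs.simpleMin_right_le hpx hj with h1 | ⟨h1, h2⟩
        -- Here p x ≤ w s_j. Either p x already lies in the coset of x s_j, or p x s_j is covered by
        -- p x; each gives the required representative.
        · by_cases hd : cs.IsRightDescent (p * (x * cs.simple j)) j
          · obtain ⟨q, hq, e⟩ := cs.exists_mem_avoid_mul_eq hp hxj hd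
            refine ⟨q, hq, ?_⟩
            rw [← e]
            simpa [mul_assoc] using h1
          · refine ⟨p, hp, StrongLE.trans ?_ h1⟩
            rw [not_isRightDescent_iff] at hd
            refine StrongCovBy.le ⟨?_, _, (cs.isReflection_simple j).conj (p * x), by simp [mul_assoc]⟩
            simpa [mul_assoc] using hd
        · exact ⟨p, hp, by rwa [← mul_assoc]⟩
      have h3 := (h2.inv.demazureSimple j).inv
      rw [CoxeterSystem.demazureSimple, CoxeterSystem.demazureSimple, if_neg, if_neg] at h3
      · simpa using h3
      · rw [isLeftDescent_inv_iff]; exact cs.isRightDescent_iff_not_isRightDescent_mul.1 hj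
      · rwa [isLeftDescent_inv_iff]
    -- Without the descent j, x lies even below w s_j: a representative that drops to p x s_j stays
    -- in the coset of x.
    · refine StrongLE.trans (ih (fun a => ?_) ?_) hle
      · obtain ⟨p, hp, hpx⟩ := h a
        rcases cs.simpleMin_right_le hpx hj with h1 | ⟨h1, h2⟩
        · exact ⟨p, hp, h1⟩
        · obtain ⟨q, hq, e⟩ := cs.exists_mem_avoid_mul_eq hp hx h1
          exact ⟨q, hq, e ▸ h2⟩
      · omega

end CoxeterSystem

namespace CoxeterSystem

variable {B W : Type*} [Group W] {M : CoxeterMatrix B} (cs : CoxeterSystem M W)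

/-! ### Words with distinct letters -/

open scoped Classical in
/-- The product of the letters of the word `a` that lie in `S`. -/
noncomputable def subProd (a : List B) (S : Set B) : W := cs.wordProd (a.filter (· ∈ S))

theorem subProd_nil (S : Set B) : cs.subProd [] S = 1 := by simp [subProd]

theorem subProd_cons_of_mem {i : B} {S : Set B} (h : i ∈ S) (a : List B) :
    cs.subProd (i :: a) S = cs.simple i * cs.subProd a S := by
  simp [subProd, h, wordProd_cons]

theorem subProd_cons_of_notMem {i : B} {S : Set B} (h : i ∉ S) (a : List B) :
    cs.subProd (i :: a) S = cs.subProd a S := by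
  simp [subProd, h]

theorem subProd_append (a b : List B) (S : Set B) :
    cs.subProd (a ++ b) S = cs.subProd a S * cs.subProd b S := by
  simp [subProd, wordProd_append]

theorem subProd_congr {a : List B} {S T : Set B} (h : ∀ x ∈ a, x ∈ S ↔ x ∈ T) :
    cs.subProd a S = cs.subProd a T := by
  unfold subProd
  congr 1
  exact List.filter_congr fun x hx => by simp [h x hx]

open scoped Classical in
theorem subProd_filter {a : List B} {S T : Set B} (h : S ⊆ T) :
    cs.subProd (a.filter (· ∈ T)) S = cs.subProd a S := by
  unfold subProd
  rw [List.filter_filter]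
  congr 1
  refine List.filter_congr fun x _ => ?_
  by_cases hx : x ∈ S
  · simp [hx, h hx]
  · simp [hx]

theorem subProd_mem_avoid {a : List B} {S : Set B} {r : B} (h : r ∈ a → r ∉ S) :
    cs.subProd a S ∈ cs.avoid r :=
  cs.wordProd_mem_avoid (by simpa using h)

theorem commute_subProd {a : List B} {S : Set B} {w : W}
    (h : ∀ x ∈ a, Commute (cs.simple x) w) : Commute (cs.subProd a S) w := by
  unfold subProd wordProd
  refine Commute.list_prod_left _ _ fun y hy => ?_
  obtain ⟨x, hx, rfl⟩ := List.mem_map.1 hy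
  exact h x (List.mem_of_mem_filter hx)

variable {cs} in
theorem SimplesIndependent.isReduced_of_nodup (hI : cs.SimplesIndependent) {a : List B}
    (ha : a.Nodup) : cs.IsReduced a := by
  induction a with
  | nil => simp [IsReduced]
  | cons i a ih =>
    rw [List.nodup_cons] at ha
    have h := hI.not_isLeftDescent (cs.wordProd_mem_avoid ha.1)
    rw [not_isLeftDescent_iff] at h
    rw [IsReduced, wordProd_cons, h, (ih ha.2).eq, List.length_cons]

variable {cs} in
-- If r were missing from T, solving the equation for the unique factor s_r would put it in W_r.
theorem SimplesIndependent.mem_of_subProd_eq (hI : cs.SimplesIndependent) {a : List B}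
    (ha : a.Nodup) {S T : Set B} (h : cs.subProd a S = cs.subProd a T) {r : B} (hr : r ∈ a)
    (hS : r ∈ S) : r ∈ T := by
  by_contra hT
  apply hI r
  obtain ⟨l₁, l₂, rfl⟩ := List.append_of_mem hr
  rw [List.nodup_middle, List.nodup_cons, List.mem_append, not_or] at ha
  have h1 := cs.subProd_mem_avoid (a := l₁) (S := S) (r := r) fun h => absurd h ha.1.1
  have h2 := cs.subProd_mem_avoid (a := l₂) (S := S) (r := r) fun h => absurd h ha.1.2
  have h3 := cs.subProd_mem_avoid (a := l₁ ++ r :: l₂) (S := T) (r := r) fun _ => hT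
  rw [← h, subProd_append, cs.subProd_cons_of_mem hS] at h3
  rw [Subgroup.mul_mem_cancel_left _ h1, Subgroup.mul_mem_cancel_right _ h2] at h3
  exact h3

variable {cs} in
theorem SimplesIndependent.subProd_eq_iff (hI : cs.SimplesIndependent) {a : List B}
    (ha : a.Nodup) {S T : Set B} :
    cs.subProd a S = cs.subProd a T ↔ ∀ x ∈ a, x ∈ S ↔ x ∈ T :=
  ⟨fun h _ hx => ⟨hI.mem_of_subProd_eq ha h hx, hI.mem_of_subProd_eq ha h.symm hx⟩,
    cs.subProd_congr⟩

/-! ### Descent chains -/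

open scoped Classical in
/-- `DescentChain a S u` says that, reading the word `a` from left to right and multiplying the
current element (at first `u`) on the left by each letter that lies in `S`, every letter is a
left descent of the current element when it is read. -/
def DescentChain : List B → Set B → W → Prop
  | [], _, _ => True
  | i :: a, S, u =>
    cs.IsLeftDescent u i ∧ DescentChain a S (if i ∈ S then cs.simple i * u else u)

theorem descentChain_cons_of_mem {i : B} {a : List B} {S : Set B} {u : W} (h : i ∈ S) :
    cs.DescentChain (i :: a) S u ↔
      cs.IsLeftDescent u i ∧ cs.DescentChain a S (cs.simple i * u) := by
  rw [DescentChain, if_pos h]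

theorem descentChain_cons_of_notMem {i : B} {a : List B} {S : Set B} {u : W} (h : i ∉ S) :
    cs.DescentChain (i :: a) S u ↔ cs.IsLeftDescent u i ∧ cs.DescentChain a S u := by
  rw [DescentChain, if_neg h]

theorem descentChain_iff {a : List B} {S : Set B} {u : W} :
    cs.DescentChain a S u ↔ ∀ l₁ r l₂, a = l₁ ++ r :: l₂ →
      cs.IsLeftDescent ((cs.subProd l₁ S)⁻¹ * u) r := by
  have key : ∀ (i : B) (a : List B) (S : Set B) (u : W),
      cs.DescentChain (i :: a) S u ↔ cs.IsLeftDescent u i ∧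
        cs.DescentChain a S ((cs.subProd [i] S)⁻¹ * u) := by
    intro i a S u
    by_cases h : i ∈ S
    · rw [cs.descentChain_cons_of_mem h, cs.subProd_cons_of_mem h, subProd_nil, mul_one, inv_simple]
    · rw [cs.descentChain_cons_of_notMem h, cs.subProd_cons_of_notMem h, subProd_nil, inv_one,
        one_mul]
  induction a generalizing u with
  | nil => simp [DescentChain]
  | cons i a ih =>
    have ih' := @ih ((cs.subProd [i] S)⁻¹ * u)
    rw [key i a S u, and_congr_right_iff.2 fun _ => ih']
    constructor
    · rintro ⟨h1, h2⟩ l₁ r l₂ h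
      rcases l₁ with _ | ⟨j, l₁⟩
      · obtain ⟨rfl, rfl⟩ := List.cons.inj h
        simpa [subProd_nil] using h1
      · rw [List.cons_append] at h
        obtain ⟨rfl, ha⟩ := List.cons.inj h
        have := h2 l₁ r l₂ ha
        rwa [← mul_assoc, ← mul_inv_rev, ← subProd_append] at this
    · intro h
      refine ⟨by simpa [subProd_nil] using h [] i a rfl, fun l₁ r l₂ h' => ?_⟩
      have := h (i :: l₁) r l₂ (by rw [h', List.cons_append])
      rwa [← mul_assoc, ← mul_inv_rev, ← subProd_append]

theorem descentChain_congr {a : List B} {S T : Set B} {u : W} (h : ∀ x ∈ a, x ∈ S ↔ x ∈ T) :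
    cs.DescentChain a S u ↔ cs.DescentChain a T u := by
  rw [descentChain_iff, descentChain_iff]
  refine forall₄_congr fun l₁ r l₂ ha => ?_
  rw [cs.subProd_congr fun x hx => h x (by simp [ha, hx])]

variable {cs} in
theorem DescentChain.demazureWord_eq {a : List B} {S : Set B} {u : W}
    (h : cs.DescentChain a S u) : cs.demazureWord a ((cs.subProd a S)⁻¹ * u) = u := by
  induction a generalizing u with
  | nil => simp [subProd_nil, demazureWord]
  | cons i a ih =>
    by_cases hi : i ∈ S
    · rw [cs.descentChain_cons_of_mem hi] at h
      have h1 := ih h.2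
      rw [cs.subProd_cons_of_mem hi, mul_inv_rev, inv_simple, mul_assoc, demazureWord_cons, h1,
        demazureSimple, if_neg (cs.isLeftDescent_iff_not_isLeftDescent_mul.1 h.1)]
      simp
    · rw [cs.descentChain_cons_of_notMem hi] at h
      rw [cs.subProd_cons_of_notMem hi, demazureWord_cons, ih h.2, demazureSimple, if_pos h.1]

theorem exists_descentChain {a : List B} (ha : a.Nodup) {u v : W}
    (h : cs.demazureWord a v = u) :
    ∃ S ⊆ {i | i ∈ a}, v = (cs.subProd a S)⁻¹ * u ∧ cs.DescentChain a S u := by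
  classical
  induction a generalizing u with
  | nil => exact ⟨∅, Set.empty_subset _, by rw [subProd_nil, inv_one, one_mul]; exact h, trivial⟩
  | cons i a ih =>
    rw [List.nodup_cons] at ha
    rw [demazureWord_cons] at h
    obtain ⟨S, hS, h1, h2⟩ := ih ha.2 rfl
    have hiS : i ∉ S := fun hi => ha.1 (hS hi)
    rw [demazureSimple] at h
    split_ifs at h with hd
    · subst h
      refine ⟨S, fun x hx => List.mem_cons_of_mem _ (hS hx), ?_, ?_⟩
      · rw [cs.subProd_cons_of_notMem hiS]; exact h1
      · exact (cs.descentChain_cons_of_notMem hiS).2 ⟨hd, h2⟩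
    · have hu : cs.demazureWord a v = cs.simple i * u := by rw [← h]; simp
      rw [hu] at h1 h2 hd
      have hc : ∀ x ∈ a, x ∈ S ↔ x ∈ insert i S := by
        intro x hx
        have : x ≠ i := by rintro rfl; exact ha.1 hx
        simp [this]
      -- Since i does not occur in the tail, inserting it changes nothing there.
      refine ⟨insert i S, ?_, ?_, ?_⟩
      · rintro x (rfl | hx)
        · exact List.mem_cons_self
        · exact List.mem_cons_of_mem _ (hS hx)
      · rw [cs.subProd_cons_of_mem (Set.mem_insert i S), mul_inv_rev, inv_simple, mul_assoc,
          ← cs.subProd_congr hc]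
        exact h1
      · rw [cs.descentChain_cons_of_mem (Set.mem_insert i S), ← cs.descentChain_congr hc]
        exact ⟨cs.isLeftDescent_iff_not_isLeftDescent_mul.2 hd, h2⟩

variable {cs} in
theorem SimplesIndependent.descentChain_iff_demazureWord (hI : cs.SimplesIndependent)
    {a : List B} (ha : a.Nodup) {S : Set B} {u : W} :
    cs.DescentChain a S u ↔ cs.demazureWord a ((cs.subProd a S)⁻¹ * u) = u := by
  refine ⟨fun h => h.demazureWord_eq, fun h => ?_⟩
  obtain ⟨T, -, h1, h2⟩ := cs.exists_descentChain ha h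
  have h3 := (hI.subProd_eq_iff ha).1 (inv_injective (mul_right_cancel h1))
  exact (cs.descentChain_congr h3).2 h2

variable {cs} in
-- The value φ_{a∩T}(v) is squeezed between d_S v = u and φ_a(v) = u. Writing it as d_T v' with v' ≤
-- v gives v' = d_T⁻¹u, and a second squeeze gives φ_a(v') = u.
theorem SimplesIndependent.descentChain_mono (hI : cs.SimplesIndependent)
    {a : List B} (ha : a.Nodup) {S T : Set B} {u : W} (h : cs.DescentChain a S u) (hST : S ⊆ T) :
    cs.DescentChain a T u ∧
      cs.StrongLE ((cs.subProd a T)⁻¹ * u) ((cs.subProd a S)⁻¹ * u) := by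
  classical
  set v := (cs.subProd a S)⁻¹ * u with hv
  have hu : cs.demazureWord a v = u := h.demazureWord_eq
  have hsub : (a.filter (· ∈ S)).Sublist (a.filter (· ∈ T)) :=
    List.monotone_filter_right a fun x hx => by simpa using hST (by simpa using hx)
  have h1 : cs.demazureWord (a.filter (· ∈ T)) v = u := by
    refine StrongLE.antisymm (cs := cs) ?_ ?_
    · conv_rhs => rw [← hu]
      exact (StrongLE.refl v).demazureWord List.filter_sublist
    · have h2 := cs.wordProd_mul_le_demazureWord (a.filter (· ∈ S)) v
      have h3 : cs.wordProd (a.filter (· ∈ S)) * v = u := by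
        rw [hv]; exact mul_inv_cancel_left _ _
      rw [h3] at h2
      exact h2.trans ((StrongLE.refl v).demazureWord hsub)
  obtain ⟨v', hv', h2⟩ := cs.exists_demazureWord_eq_wordProd_mul
    (hI.isReduced_of_nodup (ha.filter (· ∈ T))) v
  rw [h1] at h2
  have h3 : v' = (cs.subProd a T)⁻¹ * u := by
    rw [h2, subProd]; group
  rw [← h3]
  refine ⟨?_, hv'⟩
  rw [hI.descentChain_iff_demazureWord ha, ← h3]
  refine StrongLE.antisymm (cs := cs) ?_ ?_
  · conv_rhs => rw [← hu]
    exact hv'.demazureWord (List.Sublist.refl a)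
  · have h4 := cs.wordProd_mul_le_demazureWord (a.filter (· ∈ T)) v'
    rw [← h2] at h4
    exact h4.trans ((StrongLE.refl v').demazureWord List.filter_sublist)

variable {cs} in
-- The squeeze gives φ_{a∩T}(v) = u, so v = d_{S'}⁻¹u for some S' ⊆ T; uniqueness identifies S' with
-- S on the letters of `a`.
theorem SimplesIndependent.mem_of_strongLE (hI : cs.SimplesIndependent)
    {a : List B} (ha : a.Nodup) {S T : Set B} {u : W} (hS : cs.DescentChain a S u)
    (h : cs.StrongLE ((cs.subProd a T)⁻¹ * u) ((cs.subProd a S)⁻¹ * u)) {x : B} (hx : x ∈ a)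
    (hxS : x ∈ S) : x ∈ T := by
  classical
  set v := (cs.subProd a S)⁻¹ * u with hv
  have hu : cs.demazureWord a v = u := hS.demazureWord_eq
  have h1 : cs.demazureWord (a.filter (· ∈ T)) v = u := by
    refine StrongLE.antisymm (cs := cs) ?_ ?_
    · conv_rhs => rw [← hu]
      exact (StrongLE.refl v).demazureWord List.filter_sublist
    · have h2 := cs.wordProd_mul_le_demazureWord (a.filter (· ∈ T)) ((cs.subProd a T)⁻¹ * u)
      have h3 : cs.wordProd (a.filter (· ∈ T)) * ((cs.subProd a T)⁻¹ * u) = u :=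
        mul_inv_cancel_left _ _
      rw [h3] at h2
      exact h2.trans (h.demazureWord (List.Sublist.refl _))
  obtain ⟨S', hS', h2, -⟩ := cs.exists_descentChain (ha.filter (· ∈ T)) h1
  have hS'T : S' ⊆ T := fun y hy => by simpa using (List.mem_filter.1 (hS' hy)).2
  rw [cs.subProd_filter hS'T, hv] at h2
  have h3 := (hI.subProd_eq_iff ha).1 (inv_injective (mul_right_cancel h2))
  exact hS'T ((h3 x hx).1 hxS)

/-! ### Words on a path -/

/-- Letters of the word that are not consecutive commute. -/
def IsPathWord (a : List B) : Prop :=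
  ∀ x b y, [x, b, y].Sublist a → Commute (cs.simple x) (cs.simple y)

variable {cs} in
theorem IsPathWord.sublist {a a' : List B} (h : cs.IsPathWord a) (h' : a'.Sublist a) :
    cs.IsPathWord a' := fun x b y hs => h x b y (hs.trans h')

variable {cs} in
theorem IsPathWord.commute {a l₁ l₂ : List B} {b x y : B} (h : cs.IsPathWord a)
    (ha : a = l₁ ++ b :: l₂) (hx : x ∈ l₁) (hy : y ∈ l₂) :
    Commute (cs.simple x) (cs.simple y) := by
  refine h x b y ?_
  rw [ha]
  exact List.Sublist.append (List.singleton_sublist.2 hx)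
    ((List.singleton_sublist.2 hy).cons_cons b)

variable {cs} in
-- If no letter before r is skipped, the chain for `Set.univ` applies. A skipped letter b
-- disconnects i from r: the descent condition becomes that a reflection t is an inversion, where t
-- commutes with s_i and t ≠ s_i, so passing from u to s_i u does not affect it.
theorem IsPathWord.descentChain_simple_mul (hI : cs.SimplesIndependent) {i : B} {l : List B}
    (hp : cs.IsPathWord (i :: l)) (hn : (i :: l).Nodup) {S : Set B} {u : W}
    (h : cs.DescentChain l S u) (h' : cs.DescentChain l Set.univ (cs.simple i * u)) :
    cs.DescentChain l S (cs.simple i * u) := by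
  classical
  rw [descentChain_iff] at h h' ⊢
  intro l₁ r l₂ hl
  by_cases hall : ∀ x ∈ l₁, x ∈ S
  · rw [cs.subProd_congr (T := Set.univ) fun x hx => by simp [hall x hx]]
    exact h' l₁ r l₂ hl
  · push Not at hall
    obtain ⟨b, hb, hbS⟩ := hall
    have h0 := h l₁ r l₂ hl
    obtain ⟨x, y, rfl⟩ := List.append_of_mem hb
    have hni : i ∉ l := (List.nodup_cons.1 hn).1
    have hxy : ∀ z ∈ x, ∀ z' ∈ y ++ r :: l₂, Commute (cs.simple z) (cs.simple z') := by
      intro z hz z' hz'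
      exact hp.commute (l₁ := i :: x) (b := b) (l₂ := y ++ r :: l₂) (by simp [hl])
        (List.mem_cons_of_mem _ hz) hz'
    have hiy : ∀ z' ∈ y ++ r :: l₂, Commute (cs.simple i) (cs.simple z') := by
      intro z' hz'
      exact hp.commute (l₁ := i :: x) (b := b) (l₂ := y ++ r :: l₂) (by simp [hl])
        List.mem_cons_self hz'
    have hg : cs.subProd (x ++ b :: y) S = cs.subProd x S * cs.subProd y S := by
      rw [subProd_append, cs.subProd_cons_of_notMem hbS]
    set X := cs.subProd x S with hX
    set Y := cs.subProd y S with hY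
    have hXr : Commute X (cs.simple r) := cs.commute_subProd fun z hz => hxy z hz r (by simp)
    have hXY : Commute X Y := (cs.commute_subProd fun z' hz' =>
      (cs.commute_subProd fun z hz => hxy z hz z' (by simp [hz'])).symm).symm
    have hiY : Commute (cs.simple i) Y :=
      (cs.commute_subProd fun z' hz' => (hiy z' (by simp [hz'])).symm).symm
    have hir : Commute (cs.simple i) (cs.simple r) := hiy r (by simp)
    have ht : X * Y * cs.simple r * (X * Y)⁻¹ = Y * cs.simple r * Y⁻¹ := by
      have h1 : Commute X (Y * cs.simple r * Y⁻¹) := (hXY.mul_right hXr).mul_right hXY.inv_right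
      rw [← mul_inv_eq_iff_eq_mul.2 h1.eq]
      group
    have hit : Commute (cs.simple i) (Y * cs.simple r * Y⁻¹) :=
      (hiY.mul_right hir).mul_right hiY.inv_right
    have hri : r ≠ i := by rintro rfl; exact hni (by simp [hl])
    have hYi : Y ∈ cs.avoid i := cs.subProd_mem_avoid fun hiy => absurd (by simp [hl, hiy]) hni
    have hne : Y * cs.simple r * Y⁻¹ ≠ cs.simple i := fun h => hI i
      (h ▸ mul_mem (mul_mem hYi (cs.simple_mem_avoid hri)) (inv_mem hYi))
    rw [isLeftDescent_iff_inversionSign, inversionSign_mul, inv_inv, hg, ht] at h0 ⊢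
    rw [inversionSign_mul, inversionSign_simple, if_neg hne, zero_add, mul_assoc, ← hit.eq,
      inv_mul_cancel_left]
    exact h0

variable {cs} in
theorem IsPathWord.descentChain_inter (hI : cs.SimplesIndependent) {a : List B}
    (hp : cs.IsPathWord a) (hn : a.Nodup) {S T : Set B} {u : W}
    (hS : cs.DescentChain a S u) (hT : cs.DescentChain a T u) :
    cs.DescentChain a (S ∩ T) u := by
  induction a generalizing u with
  | nil => trivial
  | cons i l ih =>
    have hn' := (List.nodup_cons.1 hn).2
    have ih' := fun u => @ih (hp.sublist (List.sublist_cons_self i l)) hn' u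
    -- Needed when i lies in only one of the two sets. Enlarging the chain at u to `Set.univ`
    -- supplies the missing hypothesis.
    have transfer : ∀ {S T : Set B}, cs.DescentChain l S (cs.simple i * u) →
        cs.DescentChain l T u → cs.DescentChain l S u := by
      intro S T h1 h2
      have := hp.descentChain_simple_mul hI hn h1
      rw [simple_mul_simple_cancel_left] at this
      exact this (hI.descentChain_mono hn' h2 (Set.subset_univ T)).1
    by_cases hiS : i ∈ S <;> by_cases hiT : i ∈ T
    · rw [cs.descentChain_cons_of_mem hiS] at hS
      rw [cs.descentChain_cons_of_mem hiT] at hT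
      exact (cs.descentChain_cons_of_mem (S := S ∩ T) ⟨hiS, hiT⟩).2 ⟨hS.1, ih' _ hS.2 hT.2⟩
    · rw [cs.descentChain_cons_of_mem hiS] at hS
      rw [cs.descentChain_cons_of_notMem hiT] at hT
      exact (cs.descentChain_cons_of_notMem (S := S ∩ T) fun h => hiT h.2).2
        ⟨hS.1, ih' _ (transfer hS.2 hT.2) hT.2⟩
    · rw [cs.descentChain_cons_of_notMem hiS] at hS
      rw [cs.descentChain_cons_of_mem hiT] at hT
      exact (cs.descentChain_cons_of_notMem (S := S ∩ T) fun h => hiS h.1).2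
        ⟨hS.1, ih' _ hS.2 (transfer hT.2 hS.2)⟩
    · rw [cs.descentChain_cons_of_notMem hiS] at hS
      rw [cs.descentChain_cons_of_notMem hiT] at hT
      exact (cs.descentChain_cons_of_notMem (S := S ∩ T) fun h => hiS h.1).2 ⟨hS.1, ih' _ hS.2 hT.2⟩

theorem _root_.List.forall_mem_or_exists_last_notMem (l : List B) (S : Set B) :
    (∀ x ∈ l, x ∈ S) ∨ ∃ x b y, l = x ++ b :: y ∧ b ∉ S ∧ ∀ z ∈ y, z ∈ S := by
  induction l with
  | nil => simp
  | cons i l ih =>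
    rcases ih with ih | ⟨x, b, y, rfl, hb, hy⟩
    · by_cases hi : i ∈ S
      · exact Or.inl (by simpa [hi] using ih)
      · exact Or.inr ⟨[], i, l, rfl, hi, ih⟩
    · exact Or.inr ⟨i :: x, b, y, rfl, hb, hy⟩

variable {cs} in
-- Because b is skipped, the letters before it commute past y and r. Both products then start with
-- the same factor Y s_r, which cancels and takes the only r with it.
theorem IsPathWord.subProd_inv_mul_mem_avoid {l₁ l₂ x y : List B} {r b : B}
    (hp : cs.IsPathWord (l₁ ++ r :: l₂)) (hn : (l₁ ++ r :: l₂).Nodup) {S D : Set B} (hDS : D ⊆ S)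
    (hr : r ∈ D) (hl : l₁ = x ++ b :: y) (hb : b ∉ S) (hy : ∀ z ∈ y, z ∈ D) :
    (cs.subProd (l₁ ++ r :: l₂) D)⁻¹ * cs.subProd (l₁ ++ r :: l₂) S ∈ cs.avoid r := by
  have hn' := hn
  rw [List.nodup_middle, List.nodup_cons, List.mem_append, not_or] at hn'
  have h2 : ∀ S, cs.subProd l₂ S ∈ cs.avoid r := fun S =>
    cs.subProd_mem_avoid fun h => absurd h hn'.1.2
  subst hl
  have h1 : ∀ S, cs.subProd x S ∈ cs.avoid r := fun S =>
    cs.subProd_mem_avoid fun h => absurd (by simp [h]) hn'.1.1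
  have hxy : ∀ z ∈ x, ∀ z' ∈ y ++ r :: l₂, Commute (cs.simple z) (cs.simple z') := by
    intro z hz z' hz'
    exact hp.commute (l₁ := x) (b := b) (l₂ := y ++ r :: l₂) (by simp) hz hz'
  have hyS : cs.subProd y S = cs.subProd y D :=
    cs.subProd_congr fun z hz => ⟨fun _ => hy z hz, fun _ => hDS (hy z hz)⟩
  have hc : ∀ S, Commute (cs.subProd x S) (cs.subProd y D * cs.simple r) := fun S =>
    cs.commute_subProd fun z hz => Commute.mul_right
      (cs.commute_subProd fun z' hz' => (hxy z hz z' (by simp [hz'])).symm).symm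
      (hxy z hz r (by simp))
  have e : ∀ S, b ∉ S → r ∈ S → cs.subProd y S = cs.subProd y D →
      cs.subProd (x ++ b :: y ++ r :: l₂) S =
        cs.subProd y D * cs.simple r * cs.subProd x S * cs.subProd l₂ S := by
    intro S hb hr hyS
    rw [← (hc S).eq, subProd_append, subProd_append, cs.subProd_cons_of_notMem hb,
      cs.subProd_cons_of_mem hr, hyS]
    simp only [mul_assoc]
  rw [e S hb (hDS hr) hyS, e D (fun h => hb (hDS h)) hr rfl]
  have : (cs.subProd y D * cs.simple r * cs.subProd x D * cs.subProd l₂ D)⁻¹ *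
      (cs.subProd y D * cs.simple r * cs.subProd x S * cs.subProd l₂ S) =
      (cs.subProd x D * cs.subProd l₂ D)⁻¹ * (cs.subProd x S * cs.subProd l₂ S) := by group
  rw [this]
  exact mul_mem (inv_mem (mul_mem (h1 D) (h2 D))) (mul_mem (h1 S) (h2 S))

variable {cs} in
-- The last letter before r outside S ∩ T is missing from S or from T; the set missing it is the one
-- to compare with. If there is no such letter, the prefixes up to r agree.
theorem IsPathWord.subProd_inter_inv_mul_mem_avoid {a : List B} (hp : cs.IsPathWord a)
    (hn : a.Nodup) (S T : Set B) (r : B) :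
    (cs.subProd a (S ∩ T))⁻¹ * cs.subProd a S ∈ cs.avoid r ∨
      (cs.subProd a (S ∩ T))⁻¹ * cs.subProd a T ∈ cs.avoid r := by
  by_cases hr : r ∈ a
  swap
  · exact Or.inl (mul_mem (inv_mem (cs.subProd_mem_avoid fun h => absurd h hr))
      (cs.subProd_mem_avoid fun h => absurd h hr))
  by_cases hS : r ∈ S
  swap
  · exact Or.inl (mul_mem (inv_mem (cs.subProd_mem_avoid fun _ h => hS h.1))
      (cs.subProd_mem_avoid fun _ => hS))
  by_cases hT : r ∈ T
  swap
  · exact Or.inr (mul_mem (inv_mem (cs.subProd_mem_avoid fun _ h => hT h.2))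
      (cs.subProd_mem_avoid fun _ => hT))
  obtain ⟨l₁, l₂, rfl⟩ := List.append_of_mem hr
  rcases List.forall_mem_or_exists_last_notMem l₁ (S ∩ T) with h | ⟨x, b, y, hl, hb, hy⟩
  · left
    have hn' := hn
    rw [List.nodup_middle, List.nodup_cons, List.mem_append, not_or] at hn'
    have h2 : ∀ S, cs.subProd l₂ S ∈ cs.avoid r := fun S =>
      cs.subProd_mem_avoid fun h => absurd h hn'.1.2
    rw [subProd_append, subProd_append, cs.subProd_cons_of_mem hS,
      cs.subProd_cons_of_mem (show r ∈ S ∩ T from ⟨hS, hT⟩),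
      cs.subProd_congr (T := S) fun z hz => ⟨fun h => h.1, fun _ => h z hz⟩]
    have : (cs.subProd l₁ S * (cs.simple r * cs.subProd l₂ (S ∩ T)))⁻¹ *
        (cs.subProd l₁ S * (cs.simple r * cs.subProd l₂ S)) =
        (cs.subProd l₂ (S ∩ T))⁻¹ * cs.subProd l₂ S := by group
    rw [this]
    exact mul_mem (inv_mem (h2 _)) (h2 _)
  · by_cases hbS : b ∈ S
    · exact Or.inr (hp.subProd_inv_mul_mem_avoid hn Set.inter_subset_right ⟨hS, hT⟩ hl
        (fun h => hb ⟨hbS, h⟩) hy)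
    · exact Or.inl (hp.subProd_inv_mul_mem_avoid hn Set.inter_subset_left ⟨hS, hT⟩ hl hbS hy)

variable {cs} in
theorem IsPathWord.subProd_inter_inv_mul_le (hI : cs.SimplesIndependent) {a : List B}
    (hp : cs.IsPathWord a) (hn : a.Nodup) {S T : Set B} {u w : W}
    (hS : cs.StrongLE ((cs.subProd a S)⁻¹ * u) w) (hT : cs.StrongLE ((cs.subProd a T)⁻¹ * u) w) :
    cs.StrongLE ((cs.subProd a (S ∩ T))⁻¹ * u) w := by
  refine hI.strongLE_of_forall_avoid fun r => ?_
  rcases hp.subProd_inter_inv_mul_mem_avoid hn S T r with h | h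
  · refine ⟨_, inv_mem h, ?_⟩
    convert hS using 1
    group
  · refine ⟨_, inv_mem h, ?_⟩
    convert hT using 1
    group

end CoxeterSystem

/-! ### Boolean posets -/

theorem isBooleanPoset_Icc {α : Type*} [Finite α] {P A : Set α} (hPA : P ⊆ A) :
    IsBooleanPoset (· ⊆ ·) (Set.Icc P A) := by
  obtain ⟨n, ⟨e⟩⟩ := Finite.exists_equiv_fin ↥(A \ P)
  refine ⟨n, ⟨⟨⟨fun S => {x | (e.symm x).1 ∈ S.1},
    fun T => ⟨P ∪ {x | ∃ h : x ∈ A \ P, e ⟨x, h⟩ ∈ T}, Set.subset_union_left, ?_⟩, ?_, ?_⟩, ?_⟩⟩⟩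
  · rintro x (hx | ⟨h, -⟩)
    · exact hPA hx
    · exact h.1
  · rintro ⟨S, hPS, hSA⟩
    refine Subtype.ext (Set.ext fun x => ?_)
    constructor
    · rintro (hx | ⟨h, hx⟩)
      · exact hPS hx
      · simpa using hx
    · intro hx
      by_cases hP : x ∈ P
      · exact Or.inl hP
      · exact Or.inr ⟨⟨hSA hx, hP⟩, by simpa using hx⟩
  · intro T
    ext x
    constructor
    · rintro (hx | ⟨h, hx⟩)
      · exact absurd hx (e.symm x).2.2
      · simpa using hx
    · intro hx
      exact Or.inr ⟨(e.symm x).2, by simpa using hx⟩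
  · rintro ⟨S, hPS, hSA⟩ ⟨T, hPT, hTA⟩
    constructor
    · intro h x hx
      by_cases hP : x ∈ P
      · exact hPT hP
      · have h1 : e ⟨x, hSA hx, hP⟩ ∈ {y | (e.symm y).1 ∈ S} := by simpa using hx
        simpa using h h1
    · intro h x hx
      exact h hx

theorem IsBooleanPoset.of_bijOn_antitone {α β : Type*} {r : β → β → Prop} {F : Set (Set α)}
    {X : Set β} (hF : IsBooleanPoset (· ⊆ ·) F) {f : Set α → β} (hf : Set.BijOn f F X)
    (hr : ∀ S ∈ F, ∀ T ∈ F, S ⊆ T ↔ r (f T) (f S)) : IsBooleanPoset r X := by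
  obtain ⟨n, ⟨e⟩⟩ := hF
  let g : F ≃ X := hf.equiv f
  have hg : ∀ S : F, (g S : β) = f S := fun S => rfl
  -- Complementation turns the antitone bijection into an isomorphism.
  refine ⟨n, ⟨⟨(g.symm.trans e.toEquiv).trans
    ⟨fun T => Tᶜ, fun T => Tᶜ, compl_compl, compl_compl⟩, ?_⟩⟩⟩
  intro x y
  obtain ⟨S, rfl⟩ := g.surjective x
  obtain ⟨T, rfl⟩ := g.surjective y
  have h1 : (e T : Set (Fin n)) ⊆ e S ↔ (T : Set α) ⊆ S := e.map_rel_iff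
  have h2 := hr T T.2 S S.2
  simp only [Equiv.trans_apply, Equiv.symm_apply_apply, Equiv.coe_fn_mk, RelIso.coe_fn_toEquiv,
    Set.compl_subset_compl, Subrel]
  exact h1.trans h2

/-! ### The affine symmetric group -/

namespace AffineSymmetricGroup

variable {k : ℕ}

/-! ### Independence of the simple reflections, via the root lattice -/

theorem one_ne_zero_zmod (hk : 1 ≤ k) : (1 : ZMod (k + 1)) ≠ 0 := by
  intro h
  have : ((1 : ℕ) : ZMod (k + 1)) = 0 := by simpa using h
  rw [ZMod.natCast_eq_zero_iff] at this
  have := Nat.le_of_dvd one_pos this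
  omega

theorem two_ne_zero_zmod (hk : 2 ≤ k) : (2 : ZMod (k + 1)) ≠ 0 := by
  intro h
  have : ((2 : ℕ) : ZMod (k + 1)) = 0 := by exact_mod_cast h
  rw [ZMod.natCast_eq_zero_iff] at this
  have := Nat.le_of_dvd two_pos this
  omega

/-- The action of a simple reflection on the root lattice, in the basis of simple roots. -/
def rootReflection (i : ZMod (k + 1)) : Function.End (ZMod (k + 1) → ℤ) := fun v =>
  Function.update v i (v (i + 1) + v (i - 1) - v i)

theorem rootReflection_self (i : ZMod (k + 1)) (v : ZMod (k + 1) → ℤ) :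
    rootReflection i v i = v (i + 1) + v (i - 1) - v i := by simp [rootReflection]

theorem rootReflection_of_ne {i j : ZMod (k + 1)} (h : j ≠ i) (v : ZMod (k + 1) → ℤ) :
    rootReflection i v j = v j := by simp [rootReflection, h]

theorem rootReflection_mul_self (hk : 1 ≤ k) (i : ZMod (k + 1)) :
    rootReflection i * rootReflection i = 1 := by
  have h1 := one_ne_zero_zmod hk
  funext v
  ext x
  rw [Function.End.mul_apply', Function.End.one_apply']
  by_cases hx : x = i
  · subst hx
    rw [rootReflection_self, rootReflection_self, rootReflection_of_ne (by simpa using h1),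
      rootReflection_of_ne (by simpa using h1)]
    ring
  · rw [rootReflection_of_ne hx, rootReflection_of_ne hx]

theorem rootReflection_commute (i j : ZMod (k + 1)) (hij : j ≠ i) (h : j ≠ i + 1)
    (h' : i ≠ j + 1) (v : ZMod (k + 1) → ℤ) :
    rootReflection i (rootReflection j v) = rootReflection j (rootReflection i v) := by
  have e1 : i - 1 ≠ j := fun e => h' (by rw [← e]; ring)
  have e2 : j - 1 ≠ i := fun e => h (by rw [← e]; ring)
  ext x
  by_cases hx : x = i
  · subst hx
    rw [rootReflection_self, rootReflection_of_ne h.symm, rootReflection_of_ne e1,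
      rootReflection_of_ne hij.symm, rootReflection_of_ne hij.symm, rootReflection_self]
  by_cases hx' : x = j
  · subst hx'
    rw [rootReflection_self, rootReflection_of_ne h'.symm, rootReflection_of_ne e2,
      rootReflection_of_ne hij, rootReflection_of_ne hij, rootReflection_self]
  · rw [rootReflection_of_ne hx, rootReflection_of_ne hx', rootReflection_of_ne hx',
      rootReflection_of_ne hx]

theorem rootReflection_braid (hk : 2 ≤ k) (i : ZMod (k + 1)) (v : ZMod (k + 1) → ℤ) :
    rootReflection i (rootReflection (i + 1) (rootReflection i v)) =
      rootReflection (i + 1) (rootReflection i (rootReflection (i + 1) v)) := by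
  have h1 := one_ne_zero_zmod (by omega : 1 ≤ k)
  have h2 := two_ne_zero_zmod hk
  have e1 : i + 1 ≠ i := by simpa using h1
  have e2 : i - 1 ≠ i := by simpa using h1
  have e3 : i - 1 ≠ i + 1 := fun e => h2 (by linear_combination -e)
  have e4 : i + 1 + 1 ≠ i := fun e => h2 (by linear_combination e)
  have e5 : i + 1 + 1 ≠ i + 1 := fun e => h1 (by linear_combination e)
  have e6 : i + 1 - 1 = i := by ring
  have key : ∀ v : ZMod (k + 1) → ℤ, rootReflection i v i = v (i + 1) + v (i - 1) - v i :=
    rootReflection_self i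
  have key' : ∀ v : ZMod (k + 1) → ℤ,
      rootReflection (i + 1) v (i + 1) = v (i + 1 + 1) + v i - v (i + 1) := fun v => by
    rw [rootReflection_self, e6]
  ext x
  by_cases hx : x = i
  · subst hx
    simp only [key, key', rootReflection_of_ne e1, rootReflection_of_ne e1.symm,
      rootReflection_of_ne e2, rootReflection_of_ne e3, rootReflection_of_ne e4]
    ring
  by_cases hx' : x = i + 1
  · subst hx'
    simp only [key, key', rootReflection_of_ne e1, rootReflection_of_ne e1.symm,
      rootReflection_of_ne e3, rootReflection_of_ne e4,
      rootReflection_of_ne e5]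
    ring
  · simp only [rootReflection_of_ne hx, rootReflection_of_ne hx']

theorem isLiftable_rootReflection (hk : 1 ≤ k) :
    (affineCoxeterMatrix k).IsLiftable (rootReflection (k := k)) := by
  have hs := fun i v => congrFun (rootReflection_mul_self hk i) v
  simp only [Function.End.mul_apply', Function.End.one_apply'] at hs
  intro i j
  change _ ^ (if i = j then 1 else if k = 1 then 0 else if j = i + 1 ∨ i = j + 1 then 3 else 2) = _
  split_ifs with h1 h2 h3
  · rw [h1, pow_one, rootReflection_mul_self hk]
  -- For k = 1 the matrix entry 0 makes the relation a zeroth power.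
  · rfl
  · funext v
    simp only [pow_succ, pow_zero, one_mul, Function.End.mul_apply', Function.End.one_apply']
    have hk2 : 2 ≤ k := by omega
    rcases h3 with rfl | rfl
    · rw [rootReflection_braid hk2, hs, hs, hs]
    · rw [rootReflection_braid hk2, hs, hs, hs]
  · push Not at h3
    funext v
    simp only [pow_succ, pow_zero, one_mul, Function.End.mul_apply', Function.End.one_apply']
    rw [rootReflection_commute i j (Ne.symm h1) h3.1 h3.2, hs, hs]

/-- A reflection changes only its own coordinate, so W_r preserves coordinate r, whereas s_r negates
it on the simple root r. -/
theorem simplesIndependent (hk : 1 ≤ k) : (cs k).SimplesIndependent := by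
  have h1 := one_ne_zero_zmod hk
  set Φ := (cs k).lift ⟨_, isLiftable_rootReflection hk⟩ with hΦ
  have hs : ∀ i, Φ ((cs k).simple i) = rootReflection i := fun i => (cs k).lift_apply_simple _ i
  rintro r ⟨ω, hω, h⟩
  have h2 : ∀ v, Φ ((cs k).wordProd ω) v r = v r := by
    intro v
    clear h
    induction ω with
    | nil => simp [Function.End.one_apply']
    | cons i ω ih =>
      rw [List.mem_cons, not_or] at hω
      rw [CoxeterSystem.wordProd_cons, map_mul, Function.End.mul_apply', hs,
        rootReflection_of_ne hω.1, ih hω.2]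
  have h3 := h2 (Pi.single r 1)
  rw [h, hs, rootReflection_self, Pi.single_eq_same, Pi.single_eq_of_ne (by simpa using h1),
    Pi.single_eq_of_ne (by simpa using h1)] at h3
  omega

/-! ### Cyclically decreasing words and elements -/

theorem commute_simple {i j : ZMod (k + 1)} (h : i ≠ j) (h1 : j ≠ i + 1) (h2 : i ≠ j + 1) :
    Commute ((cs k).simple i) ((cs k).simple j) := by
  have hM : affineCoxeterMatrix k i j = 2 := by
    change (if i = j then 1 else if k = 1 then 0 else
      if j = i + 1 ∨ i = j + 1 then 3 else 2) = 2
    rw [if_neg h, if_neg, if_neg (by tauto)]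
    rintro rfl
    revert i j
    decide
  have := (cs k).simple_mul_simple_pow i j
  rw [hM, pow_two] at this
  rw [commute_iff_eq, ← mul_inv_eq_one, mul_inv_rev, CoxeterSystem.inv_simple,
    CoxeterSystem.inv_simple]
  exact this

theorem IsCyclicallyDecreasing.sublist {a b : List (ZMod (k + 1))}
    (h : IsCyclicallyDecreasing b) (hab : a.Sublist b) : IsCyclicallyDecreasing a :=
  ⟨h.1.sublist hab, h.2.sublist hab⟩

/-- The product of a cyclically decreasing word only depends on its set of letters. -/
theorem IsCyclicallyDecreasing.wordProd_eq {a b : List (ZMod (k + 1))}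
    (ha : IsCyclicallyDecreasing a) (hb : IsCyclicallyDecreasing b) (h : ∀ i, i ∈ a ↔ i ∈ b) :
    (cs k).wordProd a = (cs k).wordProd b := by
  induction a generalizing b with
  | nil =>
    have : b = [] := List.eq_nil_iff_forall_not_mem.2 fun i hi => by simpa using (h i).2 hi
    rw [this]
  | cons i a ih =>
    obtain ⟨p, q, rfl⟩ := List.append_of_mem ((h i).1 List.mem_cons_self)
    have hsub : (p ++ q).Sublist (p ++ i :: q) :=
      List.Sublist.append_left (List.sublist_cons_self i q) p
    have hia := (List.nodup_cons.1 ha.1).1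
    have hn := hb.1
    rw [List.nodup_middle, List.nodup_cons] at hn
    have h' : ∀ j, j ∈ a ↔ j ∈ p ++ q := by
      intro j
      by_cases hj : j = i
      · subst hj; exact iff_of_false hia hn.1
      · simpa [hj] using h j
    rw [CoxeterSystem.wordProd_cons,
      ih (ha.sublist (List.sublist_cons_self i a)) (hb.sublist hsub) h',
      CoxeterSystem.wordProd_append, CoxeterSystem.wordProd_append, CoxeterSystem.wordProd_cons,
      ← mul_assoc, ← mul_assoc]
    congr 1
    -- A letter x before i in `b` follows i in `a`; the two orders exclude i = x + 1 and x = i + 1,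
    -- so s_x and s_i commute.
    refine Commute.list_prod_right _ _ fun y hy => ?_
    obtain ⟨x, hx, rfl⟩ := List.mem_map.1 hy
    have hxa : x ∈ a := (h' x).2 (by simp [hx])
    refine commute_simple (by rintro rfl; exact hia hxa) ?_ ?_
    · exact (List.pairwise_cons.1 ha.2).1 x hxa
    · exact (List.pairwise_append.1 hb.2).2.2 x hx i List.mem_cons_self

/-- The cyclically decreasing word containing all letters but `c`. -/
def cyclicWord (c : ZMod (k + 1)) : List (ZMod (k + 1)) :=
  (List.range k).map fun m : ℕ => c - 1 - (m : ZMod (k + 1))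

theorem natCast_zmod_inj {m n : ℕ} (hm : m ≤ k) (hn : n ≤ k) (h : (m : ZMod (k + 1)) = n) :
    m = n := by
  have h' := congrArg ZMod.val h
  rwa [ZMod.val_natCast_of_lt (by omega), ZMod.val_natCast_of_lt (by omega)] at h'

theorem isCyclicallyDecreasing_cyclicWord (c : ZMod (k + 1)) :
    IsCyclicallyDecreasing (cyclicWord c) := by
  constructor
  · refine List.Nodup.map_on ?_ List.nodup_range
    intro m hm n hn h
    rw [List.mem_range] at hm hn
    exact natCast_zmod_inj hm.le hn.le (by simpa using h)
  · rw [cyclicWord, List.pairwise_map]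
    refine List.Pairwise.imp_of_mem ?_ List.pairwise_lt_range
    intro m n hm hn hlt h
    rw [List.mem_range] at hm hn
    have h2 : ((n + 1 : ℕ) : ZMod (k + 1)) = (m : ℕ) := by
      push_cast
      linear_combination -h
    have := natCast_zmod_inj (by omega) hm.le h2
    omega

theorem mem_cyclicWord {c i : ZMod (k + 1)} (hi : i ≠ c) : i ∈ cyclicWord c := by
  rw [cyclicWord, List.mem_map]
  have hv : (((c - 1 - i).val : ℕ) : ZMod (k + 1)) = c - 1 - i := ZMod.natCast_zmod_val _
  refine ⟨(c - 1 - i).val, ?_, by rw [hv]; ring⟩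
  rw [List.mem_range]
  have hlt := ZMod.val_lt (c - 1 - i)
  rcases Nat.lt_succ_iff_lt_or_eq.1 hlt with h | h
  · exact h
  · exfalso
    rw [h] at hv
    have h0 : ((k : ZMod (k + 1)) + 1) = 0 := by exact_mod_cast ZMod.natCast_self (k + 1)
    exact hi (by linear_combination hv - h0)

/-- Letters with another between them sit at positions differing by at least 2 and at most k - 1,
hence are neither equal nor neighbours mod k + 1. -/
theorem isPathWord_cyclicWord (c : ZMod (k + 1)) : (cs k).IsPathWord (cyclicWord c) := by
  intro x b y h
  obtain ⟨l, hl, h⟩ := List.sublist_map_iff.1 h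
  have hp := List.pairwise_lt_range.sublist hl
  have hk : ∀ m ∈ l, m < k := fun m hm => List.mem_range.1 (hl.subset hm)
  match l, h with
  | [m, n, p], h =>
    simp only [List.map_cons, List.map_nil, List.cons.injEq, and_true] at h
    obtain ⟨rfl, rfl, rfl⟩ := h
    simp only [List.pairwise_cons, List.mem_cons, List.not_mem_nil, forall_eq_or_imp] at hp hk
    refine commute_simple (fun h => ?_) (fun h => ?_) (fun h => ?_)
    · have := natCast_zmod_inj (m := m) (n := p) (k := k) (by omega) (by omega) (by simpa using h)
      omega
    · have := natCast_zmod_inj (m := m) (n := p + 1) (k := k) (by omega) (by omega)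
        (by push_cast; linear_combination h)
      omega
    · have := natCast_zmod_inj (m := m + 1) (n := p) (k := k) (by omega) (by omega)
        (by push_cast; linear_combination -h)
      omega

theorem cycDec_eq_subProd {c : ZMod (k + 1)} {S : Set (ZMod (k + 1))} (hc : c ∉ S) :
    cycDec S = (cs k).subProd (cyclicWord c) S := by
  classical
  have hS : S ≠ Set.univ := fun h => hc (h ▸ Set.mem_univ c)
  rw [cycDec, dif_pos hS]
  obtain ⟨h1, h2⟩ := (exists_isCyclicallyDecreasing hS).choose_spec
  refine h1.wordProd_eq ((isCyclicallyDecreasing_cyclicWord c).sublist List.filter_sublist)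
    fun i => ?_
  have h3 : i ∈ (exists_isCyclicallyDecreasing hS).choose ↔ i ∈ S := by
    conv_rhs => rw [← h2]
    rfl
  rw [h3, List.mem_filter, decide_eq_true_eq]
  exact ⟨fun h => ⟨mem_cyclicWord fun e => hc (e ▸ h), h⟩, fun h => h.2⟩

theorem cycDec_mem_avoid_iff (hk : 1 ≤ k) {S : Set (ZMod (k + 1))} (hS : S ≠ Set.univ)
    {r : ZMod (k + 1)} : cycDec S ∈ (cs k).avoid r ↔ r ∉ S := by
  obtain ⟨c, hc⟩ := (Set.ne_univ_iff_exists_notMem S).1 hS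
  rw [cycDec_eq_subProd hc]
  constructor
  · intro h hr
    have hn := (isCyclicallyDecreasing_cyclicWord c).1
    obtain ⟨l₁, l₂, hl⟩ := List.append_of_mem (mem_cyclicWord fun e : r = c => hc (e ▸ hr))
    rw [hl] at h hn
    rw [List.nodup_middle, List.nodup_cons, List.mem_append, not_or] at hn
    have h1 := (cs k).subProd_mem_avoid (a := l₁) (S := S) (r := r) fun h => absurd h hn.1.1
    have h2 := (cs k).subProd_mem_avoid (a := l₂) (S := S) (r := r) fun h => absurd h hn.1.2
    rw [CoxeterSystem.subProd_append, (cs k).subProd_cons_of_mem hr,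
      Subgroup.mul_mem_cancel_left _ h1, Subgroup.mul_mem_cancel_right _ h2] at h
    exact simplesIndependent hk r h
  · intro hr
    exact (cs k).subProd_mem_avoid fun _ => hr

/-- S is recovered as the set of r with d_S ∉ W_r. No common word is needed, so S and T may omit
different letters. -/
theorem cycDec_injOn (hk : 1 ≤ k) :
    Set.InjOn (cycDec (k := k)) {S | S ≠ Set.univ} := by
  intro S hS T hT h
  ext r
  rw [← not_iff_not, ← cycDec_mem_avoid_iff hk hS, ← cycDec_mem_avoid_iff hk hT, h]

end AffineSymmetricGroup

/-! ### Structure of the fibers -/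

namespace AffineSymmetricGroup

variable {k : ℕ}

/-- A letter omitted by A is omitted by all its subsets, so one word serves for every d_S with S ⊆
A. -/
theorem exists_word_of_ne_univ (hk : 1 ≤ k) {A : Set (ZMod (k + 1))} (hA : A ≠ Set.univ) :
    ∃ a : List (ZMod (k + 1)), a.Nodup ∧ (cs k).IsPathWord a ∧ (∀ i, i ∈ a ↔ i ∈ A) ∧
      (∀ S ⊆ A, cycDec S = (cs k).subProd a S) ∧
      ∀ v, (cs k).demazureProd (cycDec A) v = (cs k).demazureWord a v := by
  classical
  obtain ⟨c, hc⟩ := (Set.ne_univ_iff_exists_notMem A).1 hA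
  have hn := (isCyclicallyDecreasing_cyclicWord c).1.filter (· ∈ A)
  refine ⟨(cyclicWord c).filter (· ∈ A), hn,
    (isPathWord_cyclicWord c).sublist List.filter_sublist, fun i => ?_, fun S hS => ?_,
    fun v => ?_⟩
  · rw [List.mem_filter, decide_eq_true_eq]
    exact ⟨fun h => h.2, fun h => ⟨mem_cyclicWord fun e => hc (e ▸ h), h⟩⟩
  · rw [(cs k).subProd_filter hS, cycDec_eq_subProd fun h => hc (hS h)]
  · rw [cycDec_eq_subProd hc, CoxeterSystem.subProd]
    have h := (cs k).demazureProd_wordProd ((simplesIndependent hk).isReduced_of_nodup hn) v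
    convert h

/-- The structure of the truncation of a fiber by a lower set `P` of the strong order for which
`d_S⁻¹ u ∈ P` and `d_T⁻¹ u ∈ P` imply `d_{S ∩ T}⁻¹ u ∈ P`. -/
theorem fiber_inter_structure (hk : 1 ≤ k) {A : Set (ZMod (k + 1))} (hA : A ≠ Set.univ)
    (u : AffineSymmetricGroup k) {P : Set (AffineSymmetricGroup k)}
    (hlower : ∀ v v', (cs k).StrongLE v v' → v' ∈ P → v ∈ P)
    (hinter : ∀ S ⊆ A, ∀ T ⊆ A, cycDecInvMul u S ∈ P → cycDecInvMul u T ∈ P →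
      cycDecInvMul u (S ∩ T) ∈ P) :
    IsAntiIso u (indexFamily u (fiberX A u ∩ P)) (fiberX A u ∩ P) ∧
      ((fiberX A u ∩ P).Nonempty →
        indexFamily u (fiberX A u ∩ P) = Set.Icc (⋂₀ indexFamily u (fiberX A u ∩ P)) A ∧
        IsBooleanPoset (· ⊆ ·) (indexFamily u (fiberX A u ∩ P)) ∧
        IsBooleanPoset (cs k).StrongLE (fiberX A u ∩ P)) := by
  have hI := simplesIndependent hk
  obtain ⟨a, hn, hp, hmem, hprod, hdem⟩ := exists_word_of_ne_univ hk hA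
  have hproper : ∀ S ⊆ A, S ≠ Set.univ := fun S hS h => hA (Set.univ_subset_iff.1 (h ▸ hS))
  have hmul : ∀ S ⊆ A, cycDecInvMul u S = ((cs k).subProd a S)⁻¹ * u := fun S hS => by
    rw [cycDecInvMul, hprod S hS]
  have hX : ∀ v, v ∈ fiberX A u ↔ (cs k).demazureWord a v = u := fun v => by
    rw [fiberX, Set.mem_ofPred_eq, hdem]
  have hinj : Set.InjOn (cycDecInvMul u) {S | S ≠ Set.univ} := fun S hS T hT h =>
    cycDec_injOn hk hS hT (inv_injective (mul_right_cancel h))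
  have hsurj : ∀ v ∈ fiberX A u, ∃ S ⊆ A, cycDecInvMul u S = v ∧ (cs k).DescentChain a S u := by
    intro v hv
    obtain ⟨S, hS, h1, h2⟩ := (cs k).exists_descentChain hn ((hX v).1 hv)
    have hSA : S ⊆ A := fun i hi => (hmem i).1 (hS hi)
    exact ⟨S, hSA, by rw [hmul S hSA, h1], h2⟩
  have hF : ∀ S, S ∈ indexFamily u (fiberX A u ∩ P) ↔
      S ⊆ A ∧ (cs k).DescentChain a S u ∧ cycDecInvMul u S ∈ P := by
    intro S
    constructor
    · rintro ⟨h1, h2, h3⟩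
      obtain ⟨T, hT, h4, h5⟩ := hsurj _ h2
      -- Injectivity on all proper subsets rules out index sets not contained in A.
      obtain rfl := hinj (hproper T hT) h1 h4
      exact ⟨hT, h5, h3⟩
    · rintro ⟨h1, h2, h3⟩
      refine ⟨hproper S h1, (hX _).2 ?_, h3⟩
      rw [hmul S h1]
      exact h2.demazureWord_eq
  have hbij : Set.BijOn (cycDecInvMul u) (indexFamily u (fiberX A u ∩ P)) (fiberX A u ∩ P) := by
    refine ⟨fun S hS => hS.2, hinj.mono fun S hS => hS.1, ?_⟩
    rintro v ⟨hv, hvP⟩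
    obtain ⟨S, hS, rfl, h⟩ := hsurj v hv
    exact ⟨S, (hF S).2 ⟨hS, h, hvP⟩, rfl⟩
  have horder : ∀ S ∈ indexFamily u (fiberX A u ∩ P), ∀ T ∈ indexFamily u (fiberX A u ∩ P),
      S ⊆ T ↔ (cs k).StrongLE (cycDecInvMul u T) (cycDecInvMul u S) := by
    intro S hS T hT
    rw [hF] at hS hT
    rw [hmul S hS.1, hmul T hT.1]
    refine ⟨fun h => (hI.descentChain_mono hn hS.2.1 h).2, fun h i hi => ?_⟩
    exact hI.mem_of_strongLE hn hS.2.1 h ((hmem i).2 (hS.1 hi)) hi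
  refine ⟨⟨hbij, horder⟩, fun hne => ?_⟩
  have hcap : ⋂₀ indexFamily u (fiberX A u ∩ P) ∈ indexFamily u (fiberX A u ∩ P) := by
    obtain ⟨v, hv⟩ := hne
    obtain ⟨S₀, hS₀, -⟩ := hbij.surjOn hv
    -- In a finite family closed under intersection, a minimal member is the least one.
    obtain ⟨m, hm⟩ := (Set.toFinite (indexFamily u (fiberX A u ∩ P))).exists_minimal ⟨S₀, hS₀⟩
    have : ⋂₀ indexFamily u (fiberX A u ∩ P) = m := by
      refine Set.Subset.antisymm (Set.sInter_subset_of_mem hm.prop) ?_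
      refine Set.subset_sInter fun T hT => ?_
      have h1 := (hF m).1 hm.prop
      have h2 := (hF T).1 hT
      have h3 : m ∩ T ∈ indexFamily u (fiberX A u ∩ P) :=
        (hF _).2 ⟨fun i hi => h1.1 hi.1, hp.descentChain_inter hI hn h1.2.1 h2.2.1,
          hinter m h1.1 T h2.1 h1.2.2 h2.2.2⟩
      exact fun i hi => (hm.le_of_le h3 Set.inter_subset_left hi).2
    rw [this]
    exact hm.prop
  have hIcc : indexFamily u (fiberX A u ∩ P) =
      Set.Icc (⋂₀ indexFamily u (fiberX A u ∩ P)) A := by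
    refine Set.Subset.antisymm (fun S hS => ⟨Set.sInter_subset_of_mem hS, ((hF S).1 hS).1⟩) ?_
    rintro T ⟨h1, h2⟩
    obtain ⟨h3, h4, h5⟩ := (hF _).1 hcap
    obtain ⟨h6, h7⟩ := hI.descentChain_mono hn h4 h1
    refine (hF T).2 ⟨h2, h6, hlower _ _ ?_ h5⟩
    rw [hmul T h2, hmul _ h3]
    exact h7
  have hbool : IsBooleanPoset (· ⊆ ·) (indexFamily u (fiberX A u ∩ P)) := by
    rw [hIcc]
    exact isBooleanPoset_Icc ((hF _).1 hcap).1
  exact ⟨hIcc, hbool, hbool.of_bijOn_antitone hbij horder⟩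

end AffineSymmetricGroup

open AffineSymmetricGroup in
theorem mainTheorem6 (k : ℕ) (hk : 1 ≤ k) (A : Set (ZMod (k + 1))) (hA : A ≠ Set.univ)
    (u w : AffineSymmetricGroup k) :
    (IsAntiIso u (indexFamily u (fiberX A u)) (fiberX A u) ∧
      ((fiberX A u).Nonempty →
        indexFamily u (fiberX A u) = Set.Icc (⋂₀ indexFamily u (fiberX A u)) A ∧
        IsBooleanPoset (· ⊆ ·) (indexFamily u (fiberX A u)) ∧
        IsBooleanPoset (cs k).StrongLE (fiberX A u))) ∧
    (IsAntiIso u (indexFamily u (fiberY A u w)) (fiberY A u w) ∧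
      ((fiberY A u w).Nonempty →
        indexFamily u (fiberY A u w) = Set.Icc (⋂₀ indexFamily u (fiberY A u w)) A ∧
        IsBooleanPoset (· ⊆ ·) (indexFamily u (fiberY A u w)) ∧
        IsBooleanPoset (cs k).StrongLE (fiberY A u w))) := by
  constructor
  · have h := fiber_inter_structure hk hA u (P := Set.univ) (fun _ _ _ _ => Set.mem_univ _)
      (fun _ _ _ _ _ _ => Set.mem_univ _)
    simpa only [Set.inter_univ] using h
  · refine fiber_inter_structure hk hA u
      (fun v v' h h' => ⟨(cs k).one_strongLE v, h.trans h'.2⟩) fun S hS T hT h1 h2 => ?_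
    obtain ⟨a, hn, hp, -, hprod, -⟩ := exists_word_of_ne_univ hk hA
    refine ⟨(cs k).one_strongLE _, ?_⟩
    have h1' := h1.2
    have h2' := h2.2
    rw [cycDecInvMul, hprod _ hS] at h1'
    rw [cycDecInvMul, hprod _ hT] at h2'
    rw [cycDecInvMul, hprod _ fun i hi => hS hi.1]
    exact hp.subProd_inter_inv_mul_le (simplesIndependent hk) hn h1' h2'
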